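/- Let $\xi=(\varphi,\psi):\mathbb C^*\to\mathbb C^2$ be given by Laurent polynomials $\varphi=a\,t^{p}+\dots+a'\,t^{-r}$, $\psi=b\,t^{q}+\dots+b'\,t^{-s}$ with $a,a',b,b'\neq 0$ and $p,q,r,s\in\mathbb Z$ (negative values are allowed). Assume that $\xi$ goes to infinity as $t\to\infty$ and as $t\to 0$ (i.e. $\max(p,q)>0$ and $\max(r,s)>0$), and that $\xi$ is one-to-one outside a finite set of parameters, so that $\xi$ is the normalization of the curve $\mathcal C=\xi(\mathbb C^*)$. Let $f=0$ be a reduced polynomial equation of $\mathcal C$, and let $X_f=f_y\,\partial_x-f_x\,\partial_y$. Let $\xi^*X_f$ be the pulled-back vector field on $\mathbb C^*$ (defined by $d\xi(\xi^*X_f)=X_f\circ\xi$), let $h:\mathbb C^*\to\mathbb R_{+}$ be any smooth positive function tending to zero so fast near $0$ and $\infty$ that $\widetilde X=h\cdot\xi^*X_f$ extends continuously by zero to $0,\infty\in\mathbb{CP}^1$, and let $i_0\widetilde X$, $i_\infty\widetilde X$ be the indices of $\widetilde X$ at $t=0$ and $t=\infty$. For a singular point $P\in\mathbb C^2$ of $\mathcal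 C$ put $2\delta_P=\sum_{t\in\xi^{-1}(P)} i_t(\xi^*X_f)$. Put $p'=\gcd(p,q)$, $r'=\gcd(r,s)$, $$2\delta_{\max}=(p+r-1)(q+s-1)-(p'+r'-1)+|ps-rq| .$$ The number $\delta_{\inf}$ of double points hidden at infinity is defined as follows. If $ps\ne rq$, then $\delta_{\inf}=\delta_0+\delta_\infty$, where $$2\delta_0=\big[(r-1)(s-1)-(r'-1)+\max(ps,rq)\big]-(2-i_0\widetilde X),$$ $$2\delta_\infty=\big[(p-1)(q-1)-(p'-1)+\max(ps,rq)\big]-(2-i_\infty\widetilde X).$$ If $ps=rq$, then $$2\delta_{\inf}=2\delta_{\max}-(2-i_\infty\widetilde X-i_0\widetilde X).$$ Then all these indices are well defined, $\mathcal C$ has finitely many singular points, each with finitely many preimages under $\xi$, and in both cases ($ps\neq rq$ and $ps=rq$) $$2\delta_{\inf}+\sum_{P}2\delta_{P}=2\delta_{\max},$$ where the sum runs over the finite singular points $P$ of $\mathcal C$. If moreover $\xi$ has no self-intersections, i.e. is one-to-one on $\mathbb C^*$, then $\xi(t)$ is a singular point of $\mathcal C$ exactly when $\xi'(t)=0$,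 so that $$2\delta_{\inf}+\sum_{t\in\mathbb C^*,\ \xi'(t)=0}2\delta_{\xi(t)}=2\delta_{\max},$$ i.e. all the double points are hidden at infinity and at the finite cuspidal singularities. -/

import Mathlib

open Filter Topology
open scoped LaurentPolynomial ContDiff

noncomputable section

namespace PlaneAnnulus

/-! ### Parametrized annuli -/

/-- The value `∑ aₙ tⁿ` of the Laurent polynomial `φ = ∑ aₙ Tⁿ` at a complex number `t`
(meaningful for `t ≠ 0`). -/
def evalL (φ : ℂ[T;T⁻¹]) (t : ℂ) : ℂ := φ.coeff.sum fun n a => a * t ^ n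

/-- The parametrization `ξ = (φ, ψ)`, used for `t ≠ 0`. -/
def param (φ ψ : ℂ[T;T⁻¹]) (t : ℂ) : ℂ × ℂ := (evalL φ t, evalL ψ t)

/-- `φ = a t ^ p + (terms in between) + b t ^ (-r)` with `a ≠ 0` and `b ≠ 0`;
the integers `p` and `r` may be negative. -/
structure HasExponents (φ : ℂ[T;T⁻¹]) (p r : ℤ) : Prop where
  top_ne_zero : φ.coeff p ≠ 0
  bot_ne_zero : φ.coeff (-r) ≠ 0
  mem_Icc : ∀ n : ℤ, φ.coeff n ≠ 0 → -r ≤ n ∧ n ≤ p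

/-- `ξ = (φ, ψ) : ℂ* → ℂ²` parametrizes an annulus with the exponents `p, r` (of `φ`) and `q, s`
(of `ψ`): both ends `t → ∞` and `t → 0` of `ℂ*` go to infinity in `ℂ²`, and `ξ` is one-to-one up
to finitely many parameters, that is, `ξ` is the normalization map of its image. -/
structure IsParametrizedAnnulus (φ ψ : ℂ[T;T⁻¹]) (p q r s : ℤ) : Prop where
  exponents_x : HasExponents φ p r
  exponents_y : HasExponents ψ q s
  infinite_at_infty : 0 < p ∨ 0 < q
  infinite_at_zero : 0 < r ∨ 0 < s
  generically_injective :
    {t : ℂ | t ≠ 0 ∧ ∃ u : ℂ, u ≠ 0 ∧ u ≠ t ∧ param φ ψ u = param φ ψ t}.Finite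

/-- There are no self-intersections: `ξ` is one-to-one on `ℂ*`. -/
def NoSelfIntersections (φ ψ : ℂ[T;T⁻¹]) : Prop := Set.InjOn (param φ ψ) {0}ᶜ

/-- The value of the polynomial `f` in two variables at the point `P`. -/
def evalP (f : MvPolynomial (Fin 2) ℂ) (P : ℂ × ℂ) : ℂ := MvPolynomial.eval ![P.1, P.2] f

/-- `f = 0` is a reduced equation of the curve `ξ(ℂ*)`. -/
structure IsReducedEquation (f : MvPolynomial (Fin 2) ℂ) (φ ψ : ℂ[T;T⁻¹]) : Prop where
  squarefree : Squarefree f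
  zeros : {P : ℂ × ℂ | evalP f P = 0} = param φ ψ '' {0}ᶜ

/-- The (finite) singular points of the reduced curve `f = 0` in `ℂ²`. -/
def singularPoints (f : MvPolynomial (Fin 2) ℂ) : Set (ℂ × ℂ) :=
  {P | evalP f P = 0 ∧ evalP (MvPolynomial.pderiv 0 f) P = 0 ∧
    evalP (MvPolynomial.pderiv 1 f) P = 0}

/-! ### Indices of planar vector fields -/

/-- The vector field `v` (that is, `v ∂/∂z`), defined and nowhere zero in a punctured neighbourhood
of `z₀`, has the index `n` at `z₀`: on every small circle around `z₀` the vector `v` makes `n` turns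
around the origin. `L` is a continuous logarithm of `v` along the circle. -/
def HasIndex (v : ℂ → ℂ) (z₀ : ℂ) (n : ℤ) : Prop :=
  ∀ᶠ ε in 𝓝[>] (0 : ℝ), ∃ L : ℝ → ℂ, Continuous L ∧
    (∀ θ : ℝ, v (circleMap z₀ ε θ) = Complex.exp (L θ)) ∧
    L (2 * Real.pi) = L 0 + n * (2 * Real.pi * Complex.I)

open Classical in
/-- The index of `v` at `z₀` (and `0` if there is none). -/
def index (v : ℂ → ℂ) (z₀ : ℂ) : ℤ := if h : ∃ n : ℤ, HasIndex v z₀ n then h.choose else 0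

/-- The field `v ∂/∂t` in the coordinate `τ = 1 / t` at `t = ∞`. -/
def inftyChart (v : ℂ → ℂ) (τ : ℂ) : ℂ := -τ ^ 2 * v τ⁻¹

/-! ### The Hamiltonian vector field on the normalization -/

open Classical in
/-- The pull-back by `ξ = (φ, ψ)` of the Hamiltonian field `f_y ∂/∂x - f_x ∂/∂y`, which is tangent
to the curve `f = 0`: the field `X ∂/∂t` on `ℂ*` with `X φ' = f_y ∘ ξ` and `X ψ' = - f_x ∘ ξ`.
(The value at the isolated points with `ξ' = 0` is irrelevant for the indices.) -/
def pullback (f : MvPolynomial (Fin 2) ℂ) (φ ψ : ℂ[T;T⁻¹]) (t : ℂ) : ℂ :=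
  if deriv (evalL φ) t ≠ 0 then
    evalP (MvPolynomial.pderiv 1 f) (param φ ψ t) / deriv (evalL φ) t
  else
    -evalP (MvPolynomial.pderiv 0 f) (param φ ψ t) / deriv (evalL ψ) t

/-- The field `h X ∂/∂t` on `ℂ*`. -/
def rescale (h : ℂ → ℝ) (X : ℂ → ℂ) (t : ℂ) : ℂ := h t * X t

/-- `h` is a smooth positive function on `ℂ*` that is so small near `0` and `∞` that the field
`h X ∂/∂t` extends continuously by zero to both points. -/
structure IsTaming (h : ℂ → ℝ) (X : ℂ → ℂ) : Prop where
  smooth : ContDiffOn ℝ ∞ h {0}ᶜ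
  pos : ∀ t : ℂ, t ≠ 0 → 0 < h t
  tendsto_zero : Tendsto (rescale h X) (𝓝[≠] 0) (𝓝 0)
  tendsto_infty : Tendsto (inftyChart (rescale h X)) (𝓝[≠] 0) (𝓝 0)

/-! ### Numbers of double points -/

/-- The number `δ_P` of double points of `f = 0` hidden at the point `P`: one half of the sum of the
indices of the pulled back Hamiltonian field at the preimages of `P` in `ℂ*`. -/
def deltaPoint (f : MvPolynomial (Fin 2) ℂ) (φ ψ : ℂ[T;T⁻¹]) (P : ℂ × ℂ) : ℚ :=
  (∑ᶠ t ∈ {t : ℂ | t ≠ 0 ∧ param φ ψ t = P}, (index (pullback f φ ψ) t : ℚ)) / 2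

/-- The maximal number of double points `δ_max`. -/
def deltaMax (p q r s : ℤ) : ℚ :=
  (((p + r - 1) * (q + s - 1) - ((Int.gcd p q : ℤ) + (Int.gcd r s : ℤ) - 1)
    + |p * s - r * q| : ℤ) : ℚ) / 2

/-- `δ_{0,max}`. -/
def deltaZeroMax (p q r s : ℤ) : ℚ :=
  (((r - 1) * (s - 1) - ((Int.gcd r s : ℤ) - 1) + max (p * s) (r * q) : ℤ) : ℚ) / 2

/-- `δ_{∞,max}`. -/
def deltaInftyMax (p q r s : ℤ) : ℚ :=
  (((p - 1) * (q - 1) - ((Int.gcd p q : ℤ) - 1) + max (p * s) (r * q) : ℤ) : ℚ) / 2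

/-- The number `δ_0` of double points hidden at `t = 0`, where `i₀` is the index at `t = 0`. -/
def deltaZero (p q r s i₀ : ℤ) : ℚ := deltaZeroMax p q r s - (2 - i₀) / 2

/-- The number `δ_∞` of double points hidden at `t = ∞`, where `i` is the index at `t = ∞`. -/
def deltaInfty (p q r s i : ℤ) : ℚ := deltaInftyMax p q r s - (2 - i) / 2

/-- The number `δ_inf` of double points hidden at infinity, where `i₀` and `i` are the indices
at `t = 0` and `t = ∞`. -/
def deltaInf (p q r s i₀ i : ℤ) : ℚ :=
  if p * s = r * q then deltaMax p q r s - (2 - i - i₀) / 2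
  else deltaZero p q r s i₀ + deltaInfty p q r s i

end PlaneAnnulus

end

open Filter Topology
open scoped LaurentPolynomial ContDiff

noncomputable section

namespace PlaneAnnulus

/-! ### Indices of vector fields with a pole or a zero -/

/-! The identity is Poincaré–Hopf on the sphere. Along the curve `f_y`, `f_x`, `φ'`, `ψ'` are
Laurent polynomials in `t`, so `ξ^* X_f` is a rational field `t ^ m * P / Q` with `P` and `Q`
nonzero at `0`. Multiplication by the positive `h` does not change winding numbers. The index is
therefore `m` at `0`, the difference of root multiplicities at a point of `ℂ*`, and `2 - m - deg P +
deg Q` at `∞`, where the `2` comes from `dτ = -τ ^ 2 dt`. The sum is `2` (`sum_index`). The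
exponents enter through the elementary identity `2 δ_inf = 2 δ_max - (2 - i₀ - i_∞)`
(`two_mul_deltaInf_add`).

Only singular points may contribute. This holds because `f_y ≠ 0` at `ξ(t₀)` forces `φ'(t₀) ≠ 0`
(`deriv_left_ne_zero`), and likewise for `f_x` and `ψ'`: the field is then a quotient of two
functions that are nonzero at `t₀`.

When `ξ` is injective, the converse `φ'(t₀) ≠ 0 → f_y ≠ 0` (`pderiv_one_ne_zero`) identifies
singular points with zeros of `ξ'`. It uses properness of `ξ`, since both ends go to infinity. Both
implications rest on divided differences of polynomials; a Hurwitz argument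
(`eventually_exists_zero`) gives the converse, and for the first it gives non-injectivity near
critical points. -/

lemma eventually_circleMap {z₀ : ℂ} {S : ℂ → Prop} (hS : ∀ᶠ z in 𝓝[≠] z₀, S z) :
    ∀ᶠ ε in 𝓝[>] (0 : ℝ), ∀ θ : ℝ, S (circleMap z₀ ε θ) := by
  rw [eventually_nhdsWithin_iff, Metric.eventually_nhds_iff] at hS
  obtain ⟨r, hr, hS⟩ := hS
  filter_upwards [Ioo_mem_nhdsGT hr] with ε hε θ
  apply hS
  · rw [dist_eq_norm, circleMap_sub_center, norm_circleMap_zero, abs_of_pos hε.1]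
    exact hε.2
  · exact circleMap_ne_center hε.1.ne'

/-- Two continuous logarithms along a circle differ by `2πi k(θ)` with `k` continuous and
integer-valued, hence constant, so their increments agree. This makes the choice in `index`
harmless. -/
lemma HasIndex.unique {v : ℂ → ℂ} {z₀ : ℂ} {m n : ℤ} (hm : HasIndex v z₀ m)
    (hn : HasIndex v z₀ n) : m = n := by
  obtain ⟨ε, ⟨L, hL, hvL, hLm⟩, M, hM, hvM, hMn⟩ := (hm.and hn).exists
  have hπ : (2 * Real.pi * Complex.I : ℂ) ≠ 0 := Complex.two_pi_I_ne_zero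
  have hint : ∀ θ, ∃ k : ℤ, L θ - M θ = k * (2 * Real.pi * Complex.I) := by
    intro θ
    rw [← Complex.exp_eq_one_iff, Complex.exp_sub, ← hvL, ← hvM, div_self]
    rw [hvL]
    exact Complex.exp_ne_zero _
  choose k hk using hint
  have hcont : Continuous fun θ => ((k θ : ℤ) : ℝ) := by
    have h1 : Continuous fun θ => ((L θ - M θ) / (2 * Real.pi * Complex.I)).re := by fun_prop
    convert h1 using 2 with θ
    rw [hk, mul_div_cancel_right₀ _ hπ, Complex.intCast_re]
  have hk' : Continuous k := Int.isClosedEmbedding_coe_real.isInducing.continuous_iff.mpr hcont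
  have hconst : k (2 * Real.pi) = k 0 := PreconnectedSpace.constant inferInstance hk'
  have h0 := hk 0
  have h1 := hk (2 * Real.pi)
  rw [hLm, hMn, hconst] at h1
  have h2 : ((m : ℂ) - n) * (2 * Real.pi * Complex.I) = 0 := by linear_combination h1 - h0
  have h3 : (m : ℂ) - n = 0 := (mul_eq_zero.mp h2).resolve_right hπ
  exact_mod_cast sub_eq_zero.mp h3

lemma HasIndex.existsUnique {v : ℂ → ℂ} {z₀ : ℂ} {n : ℤ} (hn : HasIndex v z₀ n) :
    ∃! n : ℤ, HasIndex v z₀ n :=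
  ⟨n, hn, fun _ h => h.unique hn⟩

lemma HasIndex.index_eq {v : ℂ → ℂ} {z₀ : ℂ} {n : ℤ} (hn : HasIndex v z₀ n) :
    index v z₀ = n := by
  have h : ∃ n : ℤ, HasIndex v z₀ n := ⟨n, hn⟩
  rw [index, dif_pos h]
  exact h.choose_spec.unique hn

/-- The index of a positive multiple of `(z - z₀) ^ n * g z` with `g z₀ ≠ 0` is `n`. -/
lemma hasIndex_of_eventuallyEq {v g : ℂ → ℂ} {c : ℂ → ℝ} {z₀ : ℂ} {n : ℤ}
    (hc : ∀ᶠ z in 𝓝[≠] z₀, ContinuousAt c z ∧ 0 < c z)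
    (hg : ∀ᶠ z in 𝓝 z₀, ContinuousAt g z) (hg₀ : g z₀ ≠ 0)
    (hv : ∀ᶠ z in 𝓝[≠] z₀, v z = c z * ((z - z₀) ^ n * g z)) : HasIndex v z₀ n := by
  -- Near `z₀` the quotient is close to `1`, so its principal logarithm is continuous on small
  -- circles and makes no turn; only `n * (log ε + iθ)` changes over a period.
  have hslit : ∀ᶠ z in 𝓝 z₀, g z / g z₀ ∈ Complex.slitPlane := by
    have h1 : ContinuousAt (fun z => g z / g z₀) z₀ := hg.self_of_nhds.div_const _
    apply h1.eventually_mem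
    apply Complex.isOpen_slitPlane.mem_nhds
    rw [div_self hg₀]
    exact Complex.one_mem_slitPlane
  have hpos : ∀ᶠ ε in 𝓝[>] (0 : ℝ), 0 < ε := self_mem_nhdsWithin
  filter_upwards [eventually_circleMap hc, eventually_circleMap (hg.filter_mono nhdsWithin_le_nhds),
    eventually_circleMap (hslit.filter_mono nhdsWithin_le_nhds), eventually_circleMap hv, hpos]
    with ε hcε hgε hsε hvε hε
  have hγ : Continuous (circleMap z₀ ε) := continuous_circleMap z₀ ε
  have hcγ : Continuous fun θ => c (circleMap z₀ ε θ) :=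
    continuous_iff_continuousAt.mpr fun θ =>
      ContinuousAt.comp (g := c) (hcε θ).1 hγ.continuousAt
  have hgγ : Continuous fun θ => g (circleMap z₀ ε θ) / g z₀ :=
    continuous_iff_continuousAt.mpr fun θ =>
      (ContinuousAt.comp (g := g) (hgε θ) hγ.continuousAt).div_const _
  refine ⟨fun θ => (Real.log (c (circleMap z₀ ε θ)) : ℂ) + n * (Real.log ε + θ * Complex.I)
    + (Complex.log (g (circleMap z₀ ε θ) / g z₀) + Complex.log (g z₀)), ?_, ?_, ?_⟩
  · have h1 : Continuous fun θ => Real.log (c (circleMap z₀ ε θ)) :=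
      hcγ.log fun θ => (hcε θ).2.ne'
    have h2 : Continuous fun θ => Complex.log (g (circleMap z₀ ε θ) / g z₀) :=
      hgγ.clog hsε
    fun_prop
  · intro θ
    rw [hvε θ, Complex.exp_add, Complex.exp_add, Complex.exp_add, Complex.exp_log hg₀,
      Complex.exp_log (Complex.slitPlane_ne_zero (hsε θ)), div_mul_cancel₀ _ hg₀,
      ← Complex.ofReal_exp, Real.exp_log (hcε θ).2, Complex.exp_int_mul, Complex.exp_add,
      ← Complex.ofReal_exp, Real.exp_log hε, circleMap_sub_center, circleMap_zero]
    ring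
  · have h1 : circleMap z₀ ε (2 * Real.pi) = circleMap z₀ ε 0 := by
      simpa using periodic_circleMap z₀ ε 0
    simp only [h1]
    push_cast
    ring

/-! ### Functions given by Laurent polynomials -/

/-- `F` agrees on `ℂ*` with a Laurent polynomial. -/
def IsLaurent (F : ℂ → ℂ) : Prop :=
  ∃ (k : ℕ) (P : Polynomial ℂ), ∀ t : ℂ, t ≠ 0 → t ^ k * F t = P.eval t

namespace IsLaurent

variable {F G : ℂ → ℂ}

lemma const (a : ℂ) : IsLaurent fun _ => a := ⟨0, Polynomial.C a, by simp⟩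

lemma zpow (n : ℤ) : IsLaurent fun t => t ^ n := by
  obtain ⟨m, rfl | rfl⟩ := n.eq_nat_or_neg
  · exact ⟨0, Polynomial.X ^ m, by simp⟩
  · refine ⟨m, 1, fun t ht => ?_⟩
    simp [ht]

lemma add (hF : IsLaurent F) (hG : IsLaurent G) : IsLaurent fun t => F t + G t := by
  obtain ⟨k, P, hP⟩ := hF
  obtain ⟨l, Q, hQ⟩ := hG
  refine ⟨k + l, Polynomial.X ^ l * P + Polynomial.X ^ k * Q, fun t ht => ?_⟩
  simp only [Polynomial.eval_add, Polynomial.eval_mul, Polynomial.eval_pow, Polynomial.eval_X,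
    ← hP t ht, ← hQ t ht]
  ring

lemma mul (hF : IsLaurent F) (hG : IsLaurent G) : IsLaurent fun t => F t * G t := by
  obtain ⟨k, P, hP⟩ := hF
  obtain ⟨l, Q, hQ⟩ := hG
  refine ⟨k + l, P * Q, fun t ht => ?_⟩
  simp only [Polynomial.eval_mul, ← hP t ht, ← hQ t ht]
  ring

lemma neg (hF : IsLaurent F) : IsLaurent fun t => -F t := by
  simpa using (const (-1)).mul hF

lemma sum {ι : Type*} (s : Finset ι) {F : ι → ℂ → ℂ} (h : ∀ i ∈ s, IsLaurent (F i)) :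
    IsLaurent fun t => ∑ i ∈ s, F i t := by
  classical
  induction s using Finset.induction_on with
  | empty => simpa using const 0
  | insert a s ha ih =>
    simp only [Finset.sum_insert ha]
    exact (h a (by simp)).add (ih fun i hi => h i (by simp [hi]))

lemma differentiableAt (hF : IsLaurent F) {t : ℂ} (ht : t ≠ 0) : DifferentiableAt ℂ F t := by
  obtain ⟨k, P, hP⟩ := hF
  have h1 : DifferentiableAt ℂ (fun t => P.eval t / t ^ k) t :=
    P.differentiable.differentiableAt.div (differentiableAt_pow k) (pow_ne_zero _ ht)
  apply h1.congr_of_eventuallyEq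
  filter_upwards [isOpen_compl_singleton.mem_nhds ht] with u hu
  rw [← hP u hu, mul_div_cancel_left₀ _ (pow_ne_zero _ hu)]

lemma analyticAt (hF : IsLaurent F) {t : ℂ} (ht : t ≠ 0) : AnalyticAt ℂ F t := by
  have h1 : DifferentiableOn ℂ F {0}ᶜ := fun u hu =>
    (hF.differentiableAt hu).differentiableWithinAt
  exact h1.analyticAt (isOpen_compl_singleton.mem_nhds ht)

lemma deriv (hF : IsLaurent F) : IsLaurent (deriv F) := by
  obtain ⟨k, P, hP⟩ := id hF
  refine ⟨k + 1, Polynomial.X * P.derivative - Polynomial.C (k : ℂ) * P, fun t ht => ?_⟩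
  have h1 : HasDerivAt (fun u => u ^ k * F u) (k * t ^ (k - 1) * F t + t ^ k * _root_.deriv F t)
      t := (hasDerivAt_pow k t).mul (hF.differentiableAt ht).hasDerivAt
  have h2 : HasDerivAt (fun u => u ^ k * F u) (P.derivative.eval t) t := by
    apply (P.hasDerivAt t).congr_of_eventuallyEq
    filter_upwards [isOpen_compl_singleton.mem_nhds ht] with u hu
    exact hP u hu
  have h3 := h1.unique h2
  simp only [Polynomial.eval_sub, Polynomial.eval_mul, Polynomial.eval_X, Polynomial.eval_C,
    ← h3, ← hP t ht]
  rcases k with _ | k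
  · simp
  · simp only [Nat.add_sub_cancel]
    ring

/-- A Laurent polynomial that does not vanish identically is `t ^ m * P t` with `P 0 ≠ 0`. -/
lemma exists_eq_zpow_mul (hF : IsLaurent F) (h : ∃ t, t ≠ 0 ∧ F t ≠ 0) :
    ∃ (m : ℤ) (P : Polynomial ℂ), P.eval 0 ≠ 0 ∧ ∀ t, t ≠ 0 → F t = t ^ m * P.eval t := by
  obtain ⟨k, P, hP⟩ := hF
  have hP0 : P ≠ 0 := by
    rintro rfl
    obtain ⟨t, ht, hFt⟩ := h
    have := hP t ht
    simp [ht, hFt] at this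
  obtain ⟨Q, hQ, hQ0⟩ := Polynomial.exists_eq_pow_rootMultiplicity_mul_and_not_dvd P hP0 0
  refine ⟨(P.rootMultiplicity 0 : ℤ) - k, Q, ?_, fun t ht => ?_⟩
  · rwa [ne_eq, ← Polynomial.IsRoot.def, ← Polynomial.dvd_iff_isRoot]
  · have h1 := hP t ht
    rw [hQ] at h1
    simp only [map_zero, sub_zero, Polynomial.eval_mul, Polynomial.eval_pow,
      Polynomial.eval_X] at h1
    rw [zpow_sub₀ ht, zpow_natCast, zpow_natCast, div_mul_eq_mul_div, ← h1,
      mul_div_cancel_left₀ _ (pow_ne_zero _ ht)]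

lemma finite_zeros (hF : IsLaurent F) (h : ∃ t, t ≠ 0 ∧ F t ≠ 0) :
    {t : ℂ | t ≠ 0 ∧ F t = 0}.Finite := by
  obtain ⟨m, P, hP0, hP⟩ := hF.exists_eq_zpow_mul h
  have hP1 : P ≠ 0 := by rintro rfl; simp at hP0
  refine (P.rootSet_finite ℂ).subset fun t ⟨ht, hFt⟩ => ?_
  rw [hP t ht] at hFt
  rw [Polynomial.mem_rootSet]
  exact ⟨hP1, by simpa [ht, zpow_ne_zero] using hFt⟩

/-- The zeros in `ℂ*` are finite in number. The alternative `t = 0` allows for the uncontrolled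
value `F 0`. -/
lemma eventually_ne_zero (hF : IsLaurent F) (h : ∃ t, t ≠ 0 ∧ F t ≠ 0) (t₀ : ℂ) :
    ∀ᶠ t in 𝓝[≠] t₀, F t ≠ 0 ∨ t = 0 := by
  have h1 := ((hF.finite_zeros h).subset Set.sdiff_subset).isClosed (s :=
    {t : ℂ | t ≠ 0 ∧ F t = 0} \ {t₀}) |>.isOpen_compl.mem_nhds (x := t₀) (by simp)
  filter_upwards [nhdsWithin_le_nhds h1, self_mem_nhdsWithin] with t ht ht'
  by_contra! h2
  exact ht ⟨⟨h2.2, h2.1⟩, ht'⟩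

lemma eq_zero_of_frequently (hF : IsLaurent F) {t₀ : ℂ} (ht₀ : t₀ ≠ 0)
    (h : ∃ᶠ t in 𝓝[≠] t₀, F t = 0) {t : ℂ} (ht : t ≠ 0) : F t = 0 := by
  by_contra h1
  refine h ?_
  filter_upwards [hF.eventually_ne_zero ⟨t, ht, h1⟩ t₀,
    nhdsWithin_le_nhds (isOpen_compl_singleton.mem_nhds ht₀)] with u hu hu'
  exact hu.resolve_right hu'

lemma eq_zero_or_eq_zero (hF : IsLaurent F) (hG : IsLaurent G)
    (h : ∀ t, t ≠ 0 → F t * G t = 0) : (∀ t, t ≠ 0 → F t = 0) ∨ ∀ t, t ≠ 0 → G t = 0 := by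
  by_contra! h1
  obtain ⟨⟨t, ht, hFt⟩, u, hu, hGu⟩ := h1
  have h2 : ∀ᶠ t in 𝓝[≠] (1 : ℂ), t ≠ 0 :=
    nhdsWithin_le_nhds (isOpen_compl_singleton.mem_nhds one_ne_zero)
  obtain ⟨w, hw1, hw2, hw3⟩ := ((hF.eventually_ne_zero ⟨t, ht, hFt⟩ 1).and
    ((hG.eventually_ne_zero ⟨u, hu, hGu⟩ 1).and h2)).exists
  exact mul_ne_zero (hw1.resolve_right hw3) (hw2.resolve_right hw3) (h w hw3)

lemma eq_of_deriv_eq_zero (hF : IsLaurent F) (h : ∀ t, t ≠ 0 → _root_.deriv F t = 0) {t u : ℂ}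
    (ht : t ≠ 0) (hu : u ≠ 0) : F t = F u := by
  have h1 : IsPreconnected ({0}ᶜ : Set ℂ) :=
    (isConnected_compl_singleton_of_one_lt_rank (by simp) 0).isPreconnected
  exact isOpen_compl_singleton.is_const_of_deriv_eq_zero h1
    (fun u hu => (hF.differentiableAt hu).differentiableWithinAt) (fun u hu => h u hu) ht hu

end IsLaurent

lemma evalL_eq_sum (φ : ℂ[T;T⁻¹]) (t : ℂ) :
    evalL φ t = ∑ n ∈ φ.coeff.support, φ.coeff n * t ^ n := rfl

lemma isLaurent_evalL (φ : ℂ[T;T⁻¹]) : IsLaurent (evalL φ) :=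
  IsLaurent.sum _ fun _ _ => (IsLaurent.const _).mul (IsLaurent.zpow _)

lemma isLaurent_evalP (g : MvPolynomial (Fin 2) ℂ) {x y : ℂ → ℂ} (hx : IsLaurent x)
    (hy : IsLaurent y) : IsLaurent fun t => evalP g (x t, y t) := by
  induction g using MvPolynomial.induction_on with
  | C a => simpa [evalP] using IsLaurent.const a
  | add g₁ g₂ h₁ h₂ => simpa [evalP] using h₁.add h₂
  | mul_X g i h =>
    fin_cases i
    · simpa [evalP] using h.mul hx
    · simpa [evalP] using h.mul hy

/-! ### Growth of a Laurent polynomial at both ends -/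

/-- Factoring out the lowest power leaves a sum with nonzero limit `a n₀`. The exponents `e` are
free so that `e n = n` treats `t → 0` and `e n = -n` treats `t → ∞`. -/
lemma tendsto_norm_sum_zpow {ι : Type*} {S : Finset ι} {a : ι → ℂ} {e : ι → ℤ} {n₀ : ι}
    (hn₀ : n₀ ∈ S) (ha : a n₀ ≠ 0) (he₀ : e n₀ < 0) (he : ∀ n ∈ S, n ≠ n₀ → e n₀ < e n) :
    Tendsto (fun t : ℂ => ‖∑ n ∈ S, a n * t ^ e n‖) (𝓝[≠] 0) atTop := by
  have h1 : Tendsto (fun t : ℂ => ∑ n ∈ S, a n * t ^ (e n - e n₀)) (𝓝[≠] 0) (𝓝 (a n₀)) := by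
    have h2 : ∑ n ∈ S, a n * (0 : ℂ) ^ (e n - e n₀) = a n₀ := by
      rw [Finset.sum_eq_single n₀]
      · simp
      · intro n hn hne
        rw [zero_zpow _ (by have := he n hn hne; omega), mul_zero]
      · exact fun h3 => absurd hn₀ h3
    rw [← h2]
    refine tendsto_finsetSum _ fun n hn => ?_
    have h3 : ContinuousAt (fun t : ℂ => t ^ (e n - e n₀)) 0 := by
      refine continuousAt_zpow₀ _ _ (Or.inr ?_)
      by_cases hne : n = n₀
      · simp [hne]
      · have := he n hn hne
        omega
    exact (h3.tendsto.mono_left nhdsWithin_le_nhds).const_mul _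
  have h4 : Tendsto (fun t : ℂ => ‖t ^ e n₀‖) (𝓝[≠] 0) atTop :=
    tendsto_norm_cobounded_atTop.comp (tendsto_zpow_nhdsNE_zero_cobounded he₀)
  refine (h4.atTop_mul_pos (norm_pos_iff.mpr ha) h1.norm).congr' ?_
  filter_upwards [self_mem_nhdsWithin] with t ht
  rw [← norm_mul, Finset.mul_sum]
  congr 1
  refine Finset.sum_congr rfl fun n _ => ?_
  rw [zpow_sub₀ ht]
  have : t ^ e n₀ ≠ 0 := zpow_ne_zero _ ht
  field_simp

lemma HasExponents.tendsto_zero {φ : ℂ[T;T⁻¹]} {p r : ℤ} (h : HasExponents φ p r) (hr : 0 < r) :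
    Tendsto (fun t => ‖evalL φ t‖) (𝓝[≠] 0) atTop := by
  refine tendsto_norm_sum_zpow (a := φ.coeff) (e := fun n => n) (n₀ := -r)
    (by simpa using h.bot_ne_zero) h.bot_ne_zero (by omega) fun n hn hne => ?_
  have := (h.mem_Icc n (by simpa using hn)).1
  omega

lemma HasExponents.tendsto_infty {φ : ℂ[T;T⁻¹]} {p r : ℤ} (h : HasExponents φ p r) (hp : 0 < p) :
    Tendsto (fun t => ‖evalL φ t⁻¹‖) (𝓝[≠] 0) atTop := by
  have h1 := tendsto_norm_sum_zpow (a := φ.coeff) (e := fun n => -n) (n₀ := p)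
    (by simpa using h.top_ne_zero) h.top_ne_zero (by omega) (S := φ.coeff.support)
    fun n hn hne => by
      have := (h.mem_Icc n (by simpa using hn)).2
      omega
  simpa only [evalL_eq_sum, inv_zpow, zpow_neg] using h1

/-- A curve that goes to infinity at both ends of `ℂ*` is bounded only over a compact set. -/
lemma IsParametrizedAnnulus.exists_isCompact {φ ψ : ℂ[T;T⁻¹]} {p q r s : ℤ}
    (h : IsParametrizedAnnulus φ ψ p q r s) (B : ℝ) :
    ∃ K : Set ℂ, IsCompact K ∧ K ⊆ {0}ᶜ ∧
      ∀ t, t ≠ 0 → t ∉ K → B < ‖evalL φ t‖ ∨ B < ‖evalL ψ t‖ := by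
  have h0 : ∀ᶠ t in 𝓝[≠] (0 : ℂ), B < ‖evalL φ t‖ ∨ B < ‖evalL ψ t‖ := by
    rcases h.infinite_at_zero with hr | hs
    · exact ((h.exponents_x.tendsto_zero hr).eventually_gt_atTop B).mono fun _ => Or.inl
    · exact ((h.exponents_y.tendsto_zero hs).eventually_gt_atTop B).mono fun _ => Or.inr
  have h1 : ∀ᶠ t in 𝓝[≠] (0 : ℂ), B < ‖evalL φ t⁻¹‖ ∨ B < ‖evalL ψ t⁻¹‖ := by
    rcases h.infinite_at_infty with hp | hq
    · exact ((h.exponents_x.tendsto_infty hp).eventually_gt_atTop B).mono fun _ => Or.inl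
    · exact ((h.exponents_y.tendsto_infty hq).eventually_gt_atTop B).mono fun _ => Or.inr
  have h2 := h0.and h1
  rw [eventually_nhdsWithin_iff, Metric.eventually_nhds_iff] at h2
  obtain ⟨ε, hε, h2⟩ := h2
  simp only [dist_zero_right, Set.mem_compl_iff, Set.mem_singleton_iff] at h2
  refine ⟨Metric.closedBall 0 ε⁻¹ \ Metric.ball 0 ε,
    (isCompact_closedBall _ _).diff Metric.isOpen_ball, ?_, fun t ht htK => ?_⟩
  · rintro t ⟨-, ht⟩ rfl
    exact ht (Metric.mem_ball_self hε)
  · by_cases h3 : ‖t‖ < ε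
    · exact (h2 h3 ht).1
    · have h4 : ε⁻¹ < ‖t‖ := by
        by_contra! h4
        exact htK ⟨by simpa using h4, by simpa using h3⟩
      have h5 := (h2 (y := t⁻¹) (by
        rw [norm_inv]; exact inv_lt_of_inv_lt₀ hε h4) (inv_ne_zero ht)).2
      rwa [inv_inv] at h5

/-! ### Polynomials in two variables -/

lemma hasDerivAt_evalP (g : MvPolynomial (Fin 2) ℂ) {x y : ℂ → ℂ} {a b t : ℂ}
    (hx : HasDerivAt x a t) (hy : HasDerivAt y b t) :
    HasDerivAt (fun t => evalP g (x t, y t)) (evalP (MvPolynomial.pderiv 0 g) (x t, y t) * a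
      + evalP (MvPolynomial.pderiv 1 g) (x t, y t) * b) t := by
  induction g using MvPolynomial.induction_on with
  | C c => simpa [evalP] using hasDerivAt_const t c
  | add g₁ g₂ h₁ h₂ =>
    simp only [evalP, map_add] at h₁ h₂ ⊢
    exact (h₁.add h₂).congr_deriv (by ring)
  | mul_X g i h =>
    fin_cases i
    · simp only [evalP, MvPolynomial.pderiv_mul, map_mul, map_add] at h ⊢
      simp only [Fin.zero_eta, MvPolynomial.eval_X, Matrix.cons_val_zero, Fin.isValue,
        MvPolynomial.pderiv_X_self, MvPolynomial.pderiv_X_of_ne (zero_ne_one' (Fin 2)), map_one,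
        map_zero]
      exact (h.mul hx).congr_deriv (by ring)
    · simp only [evalP, MvPolynomial.pderiv_mul, map_mul, map_add] at h ⊢
      simp only [Fin.mk_one, MvPolynomial.eval_X, Matrix.cons_val_one, Matrix.cons_val_zero,
        Fin.isValue, MvPolynomial.pderiv_X_self,
        MvPolynomial.pderiv_X_of_ne (one_ne_zero' (Fin 2)), map_one, map_zero]
      exact (h.mul hy).congr_deriv (by ring)

lemma continuous_evalP (g : MvPolynomial (Fin 2) ℂ) : Continuous (evalP g) := by
  unfold evalP
  refine (MvPolynomial.continuous_eval g).comp (continuous_pi fun i => ?_)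
  fin_cases i
  · exact continuous_fst
  · exact continuous_snd

/-- `Q x y y'` is the divided difference of the polynomial `g` in the second variable. -/
structure IsDividedDifference (g : MvPolynomial (Fin 2) ℂ) (Q : ℂ → ℂ → ℂ → ℂ) : Prop where
  continuous : Continuous fun z : ℂ × ℂ × ℂ => Q z.1 z.2.1 z.2.2
  differentiable : ∀ x y', Differentiable ℂ fun y => Q x y y'
  sub_eq : ∀ x y y', evalP g (x, y) - evalP g (x, y') = (y - y') * Q x y y'
  diag : ∀ x y, Q x y y = evalP (MvPolynomial.pderiv 1 g) (x, y)

/-- Induction on `g`; only multiplication by the second variable needs a Leibniz rule, `y g(y) - y'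
g(y') = y (g(y) - g(y')) + (y - y') g(y')`. -/
lemma exists_isDividedDifference (g : MvPolynomial (Fin 2) ℂ) :
    ∃ Q, IsDividedDifference g Q := by
  induction g using MvPolynomial.induction_on with
  | C a => exact ⟨fun _ _ _ => 0, by fun_prop, by fun_prop, by simp [evalP], by simp [evalP]⟩
  | add g₁ g₂ h₁ h₂ =>
    obtain ⟨Q₁, h₁⟩ := h₁
    obtain ⟨Q₂, h₂⟩ := h₂
    refine ⟨fun x y y' => Q₁ x y y' + Q₂ x y y', h₁.continuous.add h₂.continuous,
      fun x y' => (h₁.differentiable x y').add (h₂.differentiable x y'), fun x y y' => ?_,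
      fun x y => ?_⟩
    · have e₁ := h₁.sub_eq x y y'
      have e₂ := h₂.sub_eq x y y'
      simp only [evalP, map_add] at e₁ e₂ ⊢
      linear_combination e₁ + e₂
    · have e₁ := h₁.diag x y
      have e₂ := h₂.diag x y
      simp only [evalP, map_add] at e₁ e₂ ⊢
      rw [e₁, e₂]
  | mul_X g i h =>
    obtain ⟨Q, h⟩ := h
    fin_cases i
    · refine ⟨fun x y y' => x * Q x y y', continuous_fst.mul h.continuous,
        fun x y' => (h.differentiable x y').const_mul x, fun x y y' => ?_, fun x y => ?_⟩
      · have e := h.sub_eq x y y'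
        simp only [evalP, map_mul, Fin.zero_eta, MvPolynomial.eval_X, Matrix.cons_val_zero,
          Fin.isValue] at e ⊢
        linear_combination x * e
      · have e := h.diag x y
        simp only [evalP, MvPolynomial.pderiv_mul, map_mul, map_add, Fin.zero_eta,
          MvPolynomial.eval_X, Matrix.cons_val_zero, Fin.isValue,
          MvPolynomial.pderiv_X_of_ne (zero_ne_one' (Fin 2)), map_zero] at e ⊢
        rw [e]
        ring
    · refine ⟨fun x y y' => y * Q x y y' + evalP g (x, y'),
        ((continuous_fst.comp continuous_snd).mul h.continuous).add
          ((continuous_evalP g).comp (continuous_fst.prodMk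
            (continuous_snd.comp continuous_snd))),
        fun x y' => (differentiable_id.mul (h.differentiable x y')).add_const _,
        fun x y y' => ?_, fun x y => ?_⟩
      · have e := h.sub_eq x y y'
        simp only [evalP, map_mul, Fin.mk_one, MvPolynomial.eval_X, Matrix.cons_val_one,
          Matrix.cons_val_zero, Fin.isValue] at e ⊢
        linear_combination y * e
      · have e := h.diag x y
        simp only [evalP, MvPolynomial.pderiv_mul, map_mul, map_add, Fin.mk_one,
          MvPolynomial.eval_X, Matrix.cons_val_one, Matrix.cons_val_zero, Fin.isValue,
          MvPolynomial.pderiv_X_self, map_one] at e ⊢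
        rw [e]
        ring

/-! ### Reduced equations and their partial derivatives -/

lemma totalDegree_pderiv_lt {f : MvPolynomial (Fin 2) ℂ} {i : Fin 2}
    (h : MvPolynomial.pderiv i f ≠ 0) :
    (MvPolynomial.pderiv i f).totalDegree < f.totalDegree := by
  obtain ⟨m, hm, hdeg⟩ := Finset.exists_mem_eq_sup _ (MvPolynomial.support_nonempty.mpr h)
    fun m : Fin 2 →₀ ℕ => m.sum fun _ e => e
  rw [MvPolynomial.totalDegree, hdeg]
  have h1 : m + Finsupp.single i 1 ∈ f.support := by
    rw [MvPolynomial.mem_support_iff, MvPolynomial.coeff_pderiv] at hm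
    rw [MvPolynomial.mem_support_iff]
    intro h2
    simp [h2] at hm
  have h2 := MvPolynomial.le_totalDegree h1
  rw [Finsupp.sum_add_index' (fun _ => rfl) (fun _ _ _ => rfl),
    Finsupp.sum_single_index rfl] at h2
  omega

/-- A nonzero multiple of `f` has at least the degree of `f`, whereas differentiation lowers the
degree. -/
lemma pderiv_eq_zero_of_dvd {f : MvPolynomial (Fin 2) ℂ} {i : Fin 2}
    (h : f ∣ MvPolynomial.pderiv i f) : MvPolynomial.pderiv i f = 0 := by
  by_contra h1
  obtain ⟨g, hg⟩ := h
  have h2 := totalDegree_pderiv_lt h1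
  have hf : f ≠ 0 := by rintro rfl; simp at h1
  have hg0 : g ≠ 0 := by rintro rfl; simp [hg] at h1
  rw [hg, MvPolynomial.totalDegree_mul_of_isDomain hf hg0] at h2
  omega

/-- Nullstellensatz: a squarefree `f` generates a radical ideal. -/
lemma dvd_of_zeros_subset {f g : MvPolynomial (Fin 2) ℂ} (hf : Squarefree f)
    (h : ∀ P, evalP f P = 0 → evalP g P = 0) : f ∣ g := by
  have h1 : g ∈ MvPolynomial.vanishingIdeal ℂ (MvPolynomial.zeroLocus ℂ (Ideal.span {f})) := by
    intro v hv
    have hv' := hv f (Ideal.mem_span_singleton_self f)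
    have e : v = ![v 0, v 1] := by ext i; fin_cases i <;> rfl
    have h2 := h (v 0, v 1)
    have hev : ∀ g : MvPolynomial (Fin 2) ℂ, MvPolynomial.aeval v g = MvPolynomial.eval v g :=
      fun g => by rw [← MvPolynomial.coe_aeval_eq_eval]; rfl
    rw [hev] at hv' ⊢
    simp only [evalP, ← e] at h2
    exact h2 hv'
  rw [MvPolynomial.vanishingIdeal_zeroLocus_eq_radical,
    (isRadical_iff_span_singleton.mp hf.isRadical).radical, Ideal.mem_span_singleton] at h1
  exact h1

/-- The two partial derivatives of a reduced equation do not both vanish along the curve. -/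
lemma exists_pderiv_ne_zero {f : MvPolynomial (Fin 2) ℂ} (hf : Squarefree f)
    (hz : ∃ P, evalP f P = 0) :
    ∃ P, evalP f P = 0 ∧ (evalP (MvPolynomial.pderiv 0 f) P ≠ 0 ∨
      evalP (MvPolynomial.pderiv 1 f) P ≠ 0) := by
  by_contra! h
  have h0 := pderiv_eq_zero_of_dvd (dvd_of_zeros_subset hf fun P hP => (h P hP).1)
  have h1 := pderiv_eq_zero_of_dvd (dvd_of_zeros_subset hf fun P hP => (h P hP).2)
  obtain ⟨P, hP⟩ := hz
  -- With both partial derivatives zero, `f` is constant on the line from the zero `P` to `R`.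
  have hzero : ∀ R : ℂ × ℂ, evalP f R = 0 := by
    intro R
    have hd : ∀ t : ℂ, HasDerivAt
        (fun t => evalP f (P.1 + t * (R.1 - P.1), P.2 + t * (R.2 - P.2))) 0 t := by
      intro t
      have := hasDerivAt_evalP f
        (((hasDerivAt_id t).mul_const (R.1 - P.1)).const_add P.1)
        (((hasDerivAt_id t).mul_const (R.2 - P.2)).const_add P.2)
      simpa [h0, h1, evalP] using this
    have := is_const_of_deriv_eq_zero (fun t => (hd t).differentiableAt) (fun t => (hd t).deriv)
      1 0
    simpa [hP] using this
  have : f = 0 := by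
    refine MvPolynomial.funext fun v => ?_
    have e : v = ![v 0, v 1] := by ext i; fin_cases i <;> rfl
    rw [e, map_zero]
    exact hzero (v 0, v 1)
  exact hf.ne_zero this

/-! ### Zeros of holomorphic functions depending on a parameter -/

/-- Hurwitz's theorem: an isolated zero of `G t₀` persists under perturbation of `t`. Here it
follows from the quantitative open mapping theorem on a circle where `G t₀` stays away from `0`. -/
lemma eventually_exists_zero {G : ℂ → ℂ → ℂ} {t₀ y₀ : ℂ}
    (hc : ∀ y, ContinuousAt (Function.uncurry G) (t₀, y))
    (hd : ∀ t, Differentiable ℂ (G t)) (h₀ : G t₀ y₀ = 0)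
    (hne : ∃ᶠ y in 𝓝 y₀, G t₀ y ≠ 0) {U : Set ℂ} (hU : U ∈ 𝓝 y₀) :
    ∀ᶠ t in 𝓝 t₀, ∃ y ∈ U, G t y = 0 := by
  have h1 : ∀ᶠ y in 𝓝[≠] y₀, G t₀ y ≠ 0 :=
    ((hd t₀).analyticAt y₀).eventually_eq_zero_or_eventually_ne_zero.resolve_left
      fun h => hne (h.mono fun _ hy => not_not.mpr hy)
  rw [eventually_nhdsWithin_iff, Metric.eventually_nhds_iff] at h1
  obtain ⟨r, hr, h1⟩ := h1
  obtain ⟨r', hr', hU'⟩ := Metric.nhds_basis_closedBall.mem_iff.mp hU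
  obtain ⟨ρ, hρ0, hρr, hρr'⟩ : ∃ ρ, 0 < ρ ∧ ρ < r ∧ ρ ≤ r' :=
    ⟨min (r / 2) r', by positivity, (min_le_left _ _).trans_lt (by linarith), min_le_right _ _⟩
  have hcpt : IsCompact (Metric.sphere y₀ ρ) := isCompact_sphere _ _
  obtain ⟨w, hw, hmin⟩ := hcpt.exists_isMinOn (NormedSpace.sphere_nonempty.mpr hρ0.le)
    ((hd t₀).continuous.norm.continuousOn)
  set m := ‖G t₀ w‖ with hm
  have hmpos : 0 < m := norm_pos_iff.mpr (h1 (by rw [Metric.mem_sphere] at hw; linarith)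
    (Metric.ne_of_mem_sphere hw hρ0.ne'))
  have h2 : ∀ᶠ t in 𝓝 t₀, ∀ y ∈ Metric.sphere y₀ ρ, m / 2 < ‖G t y‖ := by
    refine hcpt.eventually_forall_of_forall_eventually fun y hy => ?_
    refine ((hc y).norm.eventually_mem (s := Set.Ioi (m / 2)) (Ioi_mem_nhds ?_))
    have := hmin hy
    simp only [Function.uncurry, Set.mem_ofPred_eq] at this ⊢
    linarith
  -- On the circle `‖G t y - G t y₀‖ ≥ m/2 - m/8 = 3m/8`, so the image of the disc covers the ball
  -- of radius `3m/16` about `G t y₀`, which contains `0` because `m/8 < 3m/16`.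
  have h3 : ∀ᶠ t in 𝓝 t₀, ‖G t y₀‖ < m / 8 := by
    have h4 : ContinuousAt (fun t => ‖G t y₀‖) t₀ :=
      (ContinuousAt.comp (g := Function.uncurry G) (f := fun t => (t, y₀)) (hc y₀)
        (by fun_prop)).norm
    exact h4.eventually_lt_const (by simp only [h₀, norm_zero]; positivity)
  filter_upwards [h2, h3] with t ht2 ht3
  have hsph : ∀ y ∈ Metric.sphere y₀ ρ, 3 * m / 8 ≤ ‖G t y - G t y₀‖ := fun y hy => by
    have := ht2 y hy
    have := norm_sub_norm_le (G t y) (G t y₀)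
    linarith
  have hfreq : ∃ᶠ y in 𝓝 y₀, G t y ≠ G t y₀ := by
    intro h5
    have h6 : G t = fun _ => G t y₀ :=
      AnalyticOnNhd.eq_of_eventuallyEq (z₀ := y₀) (fun y _ => (hd t).analyticAt y)
        (fun y _ => analyticAt_const) (h5.mono fun y hy => not_not.mp hy)
    have h7 := hsph w hw
    rw [congrFun h6 w, sub_self, norm_zero] at h7
    linarith
  have h8 := DiffContOnCl.ball_subset_image_closedBall (hd t).diffContOnCl hρ0 hsph hfreq
  obtain ⟨y, hy, hy0⟩ := h8 (show (0 : ℂ) ∈ _ by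
    rw [Metric.mem_ball, dist_zero_left]; linarith)
  exact ⟨y, hU' (Metric.closedBall_subset_closedBall hρr' hy), hy0⟩

/-! ### Smooth points of the curve and of its parametrization -/

lemma eval_aeval_X (P : Polynomial ℂ) (i : Fin 2) (v : Fin 2 → ℂ) :
    MvPolynomial.eval v (Polynomial.aeval (MvPolynomial.X i) P) = P.eval (v i) := by
  induction P using Polynomial.induction_on' with
  | add p q hp hq => simp [hp, hq]
  | monomial n a => simp [Polynomial.aeval_monomial]

/-- A holomorphic function is not injective near a zero of its derivative. -/
lemma IsLaurent.eventually_exists_eq {F : ℂ → ℂ} (hF : IsLaurent F) {t₀ : ℂ} (ht₀ : t₀ ≠ 0)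
    (hd₀ : _root_.deriv F t₀ = 0) (hd : ∃ t, t ≠ 0 ∧ _root_.deriv F t ≠ 0) {U : Set ℂ}
    (hU : U ∈ 𝓝 t₀) : ∀ᶠ t in 𝓝[≠] t₀, ∃ u ∈ U, u ≠ t ∧ F u = F t := by
  obtain ⟨k, P, hP⟩ := id hF
  -- `g(t, u) = (t u) ^ k (F u - F t)` on `ℂ*`, with denominators cleared. Its divided difference at
  -- `u = t` is `t ^ (2k) F'(t)`, which vanishes at `t₀`; a nearby zero `u` for `t ≠ t₀` is off the
  -- diagonal, as `F'(t) ≠ 0` there.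
  let g : MvPolynomial (Fin 2) ℂ :=
    Polynomial.aeval (MvPolynomial.X 1) P * MvPolynomial.X 0 ^ k
      - Polynomial.aeval (MvPolynomial.X 0) P * MvPolynomial.X 1 ^ k
  have hg : ∀ a b : ℂ, evalP g (a, b) = P.eval b * a ^ k - P.eval a * b ^ k := by
    intro a b
    simp [evalP, g, eval_aeval_X]
  obtain ⟨Q, hQ⟩ := exists_isDividedDifference g
  have hgF : ∀ t u : ℂ, t ≠ 0 → u ≠ 0 → (t * u) ^ k * (F u - F t) = (u - t) * Q t u t := by
    intro t u ht hu
    rw [← hQ.sub_eq, hg, hg, ← hP t ht, ← hP u hu]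
    ring
  have hdiag : ∀ t : ℂ, t ≠ 0 → Q t t t = (t * t) ^ k * _root_.deriv F t := by
    intro t ht
    have h1 : HasDerivAt (fun u => (u - t) * Q t u t) (1 * Q t t t + (t - t) *
        _root_.deriv (fun u => Q t u t) t) t :=
      ((hasDerivAt_id t).sub_const t).mul (hQ.differentiable t t t).hasDerivAt
    have h2 : HasDerivAt (fun u => (t * u) ^ k * (F u - F t))
        (_root_.deriv (fun u => (t * u) ^ k) t * (F t - F t)
          + (t * t) ^ k * _root_.deriv F t) t := by
      have h3 : DifferentiableAt ℂ (fun u => (t * u) ^ k) t := by fun_prop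
      exact h3.hasDerivAt.mul ((hF.differentiableAt ht).hasDerivAt.sub_const (F t))
    have h3 := h2.unique (h1.congr_of_eventuallyEq
      (eventually_of_mem (isOpen_compl_singleton.mem_nhds ht) fun u hu => hgF t u ht hu))
    linear_combination -h3
  have hne : ∃ᶠ u in 𝓝 t₀, Q t₀ u t₀ ≠ 0 := by
    intro h1
    have h2 : ∀ᶠ u in 𝓝 t₀, F u = F t₀ := by
      filter_upwards [h1, isOpen_compl_singleton.mem_nhds ht₀] with u hu hu0
      have h3 := hgF t₀ u ht₀ hu0
      rw [not_not.mp hu, mul_zero] at h3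
      exact sub_eq_zero.mp ((mul_eq_zero.mp h3).resolve_left
        (pow_ne_zero _ (mul_ne_zero ht₀ hu0)))
    have h4 : ∀ᶠ u in 𝓝[≠] t₀, _root_.deriv F u = 0 := by
      refine (h2.eventually_nhds.filter_mono nhdsWithin_le_nhds).mono fun u hu => ?_
      have h5 : F =ᶠ[𝓝 u] fun _ => F t₀ := hu
      rw [h5.deriv_eq, deriv_const]
    obtain ⟨t, ht, hdt⟩ := hd
    exact hdt (hF.deriv.eq_zero_of_frequently ht₀ h4.frequently ht)
  have hcont : Continuous (Function.uncurry fun t u => Q t u t) :=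
    hQ.continuous.comp (continuous_fst.prodMk (continuous_snd.prodMk continuous_fst))
  have h0 : ({0}ᶜ : Set ℂ) ∈ 𝓝 t₀ := isOpen_compl_singleton.mem_nhds ht₀
  have hzero := eventually_exists_zero (G := fun t u => Q t u t) (t₀ := t₀) (y₀ := t₀)
    (fun y => hcont.continuousAt) (fun t => hQ.differentiable t t)
    (by rw [hdiag t₀ ht₀, hd₀, mul_zero]) hne (inter_mem hU h0)
  filter_upwards [nhdsWithin_le_nhds hzero, nhdsWithin_le_nhds h0,
    hF.deriv.eventually_ne_zero hd t₀] with t ⟨u, ⟨huU, hu0⟩, hu⟩ ht hdt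
  refine ⟨u, huU, ?_, ?_⟩
  · rintro rfl
    rw [hdiag u hu0] at hu
    exact (mul_ne_zero (pow_ne_zero _ (mul_ne_zero hu0 hu0)) (hdt.resolve_right hu0)) hu
  · have h3 := hgF t u ht hu0
    rw [hu, mul_zero] at h3
    exact sub_eq_zero.mp ((mul_eq_zero.mp h3).resolve_left (pow_ne_zero _ (mul_ne_zero ht hu0)))

/-- `t ↦ (x t, y t)` is the normalization of the reduced affine curve `f = 0`. -/
structure IsCurveParam (x y : ℂ → ℂ) (f : MvPolynomial (Fin 2) ℂ) : Prop where
  laurent_x : IsLaurent x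
  laurent_y : IsLaurent y
  squarefree : Squarefree f
  zeros : {P : ℂ × ℂ | evalP f P = 0} = (fun t => (x t, y t)) '' {0}ᶜ
  finite : {t : ℂ | t ≠ 0 ∧ ∃ u : ℂ, u ≠ 0 ∧ u ≠ t ∧ (x u, y u) = (x t, y t)}.Finite

lemma evalP_rename_swap (f : MvPolynomial (Fin 2) ℂ) (a b : ℂ) :
    evalP (MvPolynomial.rename (Equiv.swap 0 1) f) (a, b) = evalP f (b, a) := by
  rw [evalP, evalP, MvPolynomial.eval_rename]
  congr 2
  ext i
  fin_cases i <;> simp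

namespace IsCurveParam

variable {x y : ℂ → ℂ} {f : MvPolynomial (Fin 2) ℂ} (h : IsCurveParam x y f)

include h

/-- Exchanging the coordinates transfers each result about `x'` and `f_y` to `y'` and `f_x`. -/
lemma swap : IsCurveParam y x (MvPolynomial.rename (Equiv.swap 0 1) f) where
  laurent_x := h.laurent_y
  laurent_y := h.laurent_x
  squarefree := by
    intro g hg
    let e := MvPolynomial.renameEquiv ℂ (Equiv.swap (0 : Fin 2) 1)
    have h1 := map_dvd e.symm (show g * g ∣ e f from hg)
    rw [map_mul, AlgEquiv.symm_apply_apply] at h1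
    simpa using h.squarefree _ h1
  zeros := by
    ext ⟨a, b⟩
    have := Set.ext_iff.mp h.zeros (b, a)
    simp only [Set.mem_ofPred_eq, evalP_rename_swap, Set.mem_image, Prod.mk.injEq] at this ⊢
    rw [this]
    exact exists_congr fun t => and_congr_right fun _ => and_comm
  finite := by
    refine h.finite.subset ?_
    rintro t ⟨ht, u, hu, hut, he⟩
    rw [Prod.mk.injEq] at he
    exact ⟨ht, u, hu, hut, Prod.ext he.2 he.1⟩

lemma evalP_eq_zero {t : ℂ} (ht : t ≠ 0) : evalP f (x t, y t) = 0 := by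
  have : (x t, y t) ∈ (fun t => (x t, y t)) '' {0}ᶜ := ⟨t, ht, rfl⟩
  rwa [← h.zeros] at this

lemma exists_param {a b : ℂ} (hab : evalP f (a, b) = 0) : ∃ t, t ≠ 0 ∧ x t = a ∧ y t = b := by
  have : (a, b) ∈ {P : ℂ × ℂ | evalP f P = 0} := hab
  rw [h.zeros] at this
  obtain ⟨t, ht, he⟩ := this
  exact ⟨t, ht, (Prod.mk.inj he).1, (Prod.mk.inj he).2⟩

lemma chain_rule {t : ℂ} (ht : t ≠ 0) :
    evalP (MvPolynomial.pderiv 0 f) (x t, y t) * deriv x t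
      + evalP (MvPolynomial.pderiv 1 f) (x t, y t) * deriv y t = 0 := by
  have h1 := hasDerivAt_evalP f (h.laurent_x.differentiableAt ht).hasDerivAt
    (h.laurent_y.differentiableAt ht).hasDerivAt
  have h2 : HasDerivAt (fun t => evalP f (x t, y t)) 0 t := by
    refine (hasDerivAt_const t (0 : ℂ)).congr_of_eventuallyEq ?_
    filter_upwards [isOpen_compl_singleton.mem_nhds ht] with u hu
    exact h.evalP_eq_zero hu
  exact h1.unique h2

lemma eventually_injective (t₀ : ℂ) : ∀ᶠ t in 𝓝[≠] t₀, t ≠ 0 →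
    ∀ u, u ≠ 0 → x u = x t → y u = y t → u = t := by
  have h1 := (h.finite.subset (Set.sdiff_subset (t := {t₀}))).isClosed.isOpen_compl.mem_nhds
    (x := t₀) (by simp)
  filter_upwards [nhdsWithin_le_nhds h1, self_mem_nhdsWithin] with t ht ht' ht0 u hu hx hy
  by_contra h2
  exact ht ⟨⟨ht0, u, hu, h2, Prod.ext hx hy⟩, ht'⟩

lemma exists_deriv_ne_zero :
    (∃ t, t ≠ 0 ∧ deriv x t ≠ 0) ∨ ∃ t, t ≠ 0 ∧ deriv y t ≠ 0 := by
  by_contra! h1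
  have h0 : ({0}ᶜ : Set ℂ) ∈ 𝓝 (1 : ℂ) := isOpen_compl_singleton.mem_nhds one_ne_zero
  obtain ⟨t, ⟨ht, ht0⟩, ht1⟩ :=
    (((h.eventually_injective 1).and (nhdsWithin_le_nhds h0)).and self_mem_nhdsWithin).exists
  exact ht1 (ht ht0 1 one_ne_zero (h.laurent_x.eq_of_deriv_eq_zero h1.1 one_ne_zero ht0)
    (h.laurent_y.eq_of_deriv_eq_zero h1.2 one_ne_zero ht0)).symm

/-- If `f_y` vanished along the curve, the chain rule would give `f_x x' = 0`, hence `f_x = 0` along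
it too, which a reduced equation excludes. -/
lemma exists_pderiv_one_ne_zero (hx : ∃ t, t ≠ 0 ∧ deriv x t ≠ 0) :
    ∃ t, t ≠ 0 ∧ evalP (MvPolynomial.pderiv 1 f) (x t, y t) ≠ 0 := by
  by_contra! h1
  have h2 : ∀ t, t ≠ 0 → evalP (MvPolynomial.pderiv 0 f) (x t, y t) = 0 := by
    refine ((isLaurent_evalP _ h.laurent_x h.laurent_y).eq_zero_or_eq_zero h.laurent_x.deriv
      fun t ht => ?_).resolve_right fun h3 => ?_
    · have := h.chain_rule ht
      rwa [h1 t ht, zero_mul, add_zero] at this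
    · obtain ⟨t, ht, hd⟩ := hx
      exact hd (h3 t ht)
  obtain ⟨⟨a, b⟩, hP, hne⟩ := exists_pderiv_ne_zero h.squarefree
    ⟨_, h.evalP_eq_zero one_ne_zero⟩
  obtain ⟨t, ht, rfl, rfl⟩ := h.exists_param hP
  exact hne.elim (fun h3 => h3 (h2 t ht)) fun h3 => h3 (h1 t ht)

/-- Where `f_y ≠ 0`, the divided difference is nonzero nearby, so points of the curve close to
`ξ(t₀)` are determined by `x`. If `x'(t₀) = 0` and `x` is not constant, `x` takes equal values at
distinct `t, u` near `t₀`; then `y` agrees too, against generic injectivity. -/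
lemma deriv_left_ne_zero {t₀ : ℂ} (ht₀ : t₀ ≠ 0)
    (hy : evalP (MvPolynomial.pderiv 1 f) (x t₀, y t₀) ≠ 0) : deriv x t₀ ≠ 0 := by
  intro hd₀
  by_cases hx : ∃ t, t ≠ 0 ∧ deriv x t ≠ 0
  · obtain ⟨Q, hQ⟩ := exists_isDividedDifference f
    have hcx := (h.laurent_x.differentiableAt ht₀).continuousAt
    have hcy := (h.laurent_y.differentiableAt ht₀).continuousAt
    have hc : ContinuousAt (fun z : ℂ × ℂ => Q (x z.1) (y z.1) (y z.2)) (t₀, t₀) := by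
      refine hQ.continuous.continuousAt.comp (f := fun z : ℂ × ℂ => (x z.1, y z.1, y z.2)) ?_
      exact (hcx.comp continuousAt_fst).prodMk
        ((hcy.comp continuousAt_fst).prodMk (hcy.comp continuousAt_snd))
    have hev : ∀ᶠ z in 𝓝 (t₀, t₀), Q (x z.1) (y z.1) (y z.2) ≠ 0 :=
      hc.eventually_ne (by rwa [hQ.diag])
    obtain ⟨U, hU, hUQ⟩ : ∃ U ∈ 𝓝 t₀, ∀ t ∈ U, ∀ u ∈ U, Q (x t) (y t) (y u) ≠ 0 := by
      obtain ⟨U, hU, V, hV, hUV⟩ := mem_nhds_prod_iff.mp hev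
      exact ⟨U ∩ V, inter_mem hU hV, fun t ht u hu => @hUV (t, u) ⟨ht.1, hu.2⟩⟩
    have h0 : ({0}ᶜ : Set ℂ) ∈ 𝓝 t₀ := isOpen_compl_singleton.mem_nhds ht₀
    obtain ⟨t, ⟨⟨u, ⟨huU, hu0⟩, hut, hxu⟩, htU, ht0⟩, hinj⟩ :=
      (((h.laurent_x.eventually_exists_eq ht₀ hd₀ hx (inter_mem hU h0)).and
        (nhdsWithin_le_nhds (inter_mem hU h0))).and (h.eventually_injective t₀)).exists
    have h1 := hQ.sub_eq (x t) (y t) (y u)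
    rw [h.evalP_eq_zero ht0, ← hxu, h.evalP_eq_zero hu0, sub_zero] at h1
    refine hut (hinj ht0 u hu0 hxu ?_)
    have h2 := (mul_eq_zero.mp h1.symm).resolve_right (by rw [hxu]; exact hUQ t htU u huU)
    exact (sub_eq_zero.mp h2).symm
  -- Here `x` is constant: the chain rule reads `f_y y' = 0` with `y'` not identically zero, so
  -- `f_y` vanishes along the curve.
  · have hy' := h.exists_deriv_ne_zero.resolve_left hx
    push Not at hx
    rcases (isLaurent_evalP _ h.laurent_x h.laurent_y).eq_zero_or_eq_zero h.laurent_y.deriv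
      (fun t ht => by
        have := h.chain_rule ht
        rwa [hx t ht, mul_zero, zero_add] at this) with h1 | h1
    · exact hy (h1 t₀ ht₀)
    · obtain ⟨t, ht, hd⟩ := hy'
      exact hd (h1 t ht)

lemma deriv_right_ne_zero {t₀ : ℂ} (ht₀ : t₀ ≠ 0)
    (hx : evalP (MvPolynomial.pderiv 0 f) (x t₀, y t₀) ≠ 0) : deriv y t₀ ≠ 0 := by
  refine h.swap.deriv_left_ne_zero ht₀ ?_
  have := MvPolynomial.pderiv_rename (Equiv.swap (0 : Fin 2) 1).injective 0 f
  rw [Equiv.swap_apply_left] at this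
  rwa [this, evalP_rename_swap]

omit h in
/-- A proper injective map is a homeomorphism onto its image. -/
lemma exists_nhds_of_proper {x y : ℂ → ℂ} (hx : IsLaurent x) (hy : IsLaurent y)
    (hinj : Set.InjOn (fun t => (x t, y t)) {0}ᶜ)
    (hprop : ∀ B : ℝ, ∃ K : Set ℂ, IsCompact K ∧ K ⊆ {0}ᶜ ∧
      ∀ t, t ≠ 0 → t ∉ K → B < ‖x t‖ ∨ B < ‖y t‖)
    {t₀ : ℂ} (ht₀ : t₀ ≠ 0) {U : Set ℂ} (hU : U ∈ 𝓝 t₀) :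
    ∃ V ∈ 𝓝 (x t₀, y t₀), ∀ u, u ≠ 0 → (x u, y u) ∈ V → u ∈ U := by
  obtain ⟨K, hK, hK0, hB⟩ := hprop (‖(x t₀, y t₀)‖ + 1)
  -- Parameters outside `U` either lie in this compact set, whose image misses `ξ(t₀)` by
  -- injectivity, or lie outside `K`, where `ξ` is too large.
  have hK' : IsCompact (K \ interior U) := hK.diff isOpen_interior
  have himg : IsCompact ((fun t => (x t, y t)) '' (K \ interior U)) := by
    refine hK'.image_of_continuousOn fun t ht => ?_
    exact (((hx.differentiableAt (hK0 ht.1)).continuousAt).prodMk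
      ((hy.differentiableAt (hK0 ht.1)).continuousAt)).continuousWithinAt
  refine ⟨((fun t => (x t, y t)) '' (K \ interior U))ᶜ ∩ Metric.ball (x t₀, y t₀) 1,
    inter_mem (himg.isClosed.isOpen_compl.mem_nhds ?_) (Metric.ball_mem_nhds _ one_pos), ?_⟩
  · rintro ⟨u, ⟨huK, huU⟩, he⟩
    rw [hinj (hK0 huK) ht₀ he] at huU
    exact huU (mem_interior_iff_mem_nhds.mpr hU)
  · rintro u hu ⟨hu1, hu2⟩
    by_contra huU
    have huK : u ∈ K := by
      by_contra huK
      have h1 : ‖(x u, y u)‖ < ‖(x t₀, y t₀)‖ + 1 := by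
        have := norm_sub_norm_le (x u, y u) (x t₀, y t₀)
        rw [Metric.mem_ball, dist_eq_norm] at hu2
        linarith
      rcases hB u hu huK with h2 | h2
      · exact absurd ((norm_fst_le (x u, y u)).trans_lt h1) h2.not_gt
      · exact absurd ((norm_snd_le (x u, y u)).trans_lt h1) h2.not_gt
    exact hu1 ⟨u, ⟨huK, fun h3 => huU (interior_subset h3)⟩, rfl⟩

/-- If `f_y = 0` at `ξ(t₀)`, then by Hurwitz `b ↦ Q (x t) b (y t)` has a zero `b` near `y t₀` for
every `t` near `t₀`, and `(x t, b)` is on the curve. Properness and local invertibility of `x` force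
`b = y t`, so `f_y` vanishes along an arc, hence along the whole curve, which is impossible. -/
lemma pderiv_one_ne_zero (hinj : Set.InjOn (fun t => (x t, y t)) {0}ᶜ)
    (hprop : ∀ B : ℝ, ∃ K : Set ℂ, IsCompact K ∧ K ⊆ {0}ᶜ ∧
      ∀ t, t ≠ 0 → t ∉ K → B < ‖x t‖ ∨ B < ‖y t‖)
    {t₀ : ℂ} (ht₀ : t₀ ≠ 0) (hd : deriv x t₀ ≠ 0) :
    evalP (MvPolynomial.pderiv 1 f) (x t₀, y t₀) ≠ 0 := by
  intro hy₀
  obtain ⟨Q, hQ⟩ := exists_isDividedDifference f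
  have hcx := (h.laurent_x.differentiableAt ht₀).continuousAt
  have hcy := (h.laurent_y.differentiableAt ht₀).continuousAt
  have hstrict : HasStrictDerivAt x (deriv x t₀) t₀ := (h.laurent_x.analyticAt ht₀).hasStrictDerivAt
  have hleft := (hstrict.hasStrictFDerivAt_equiv hd).eventually_left_inverse
  have h0 : ∀ᶠ t in 𝓝 t₀, t ≠ 0 := isOpen_compl_singleton.mem_nhds ht₀
  obtain ⟨V, hV, hVU⟩ := exists_nhds_of_proper h.laurent_x h.laurent_y hinj hprop ht₀ hleft
  obtain ⟨X, hX, Y, hY, hXY⟩ := mem_nhds_prod_iff.mp hV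
  -- The vertical line through `ξ(t)` meets the curve near `ξ(t₀)` only in `ξ(t)`: another point
  -- `ξ(u)` has `u` near `t₀` and `x u = x t`, and the local inverse of `x` gives `u = t`.
  have hunique : ∀ t b, t ≠ 0 → HasStrictFDerivAt.localInverse _ _ _
      (hstrict.hasStrictFDerivAt_equiv hd) (x t) = t → x t ∈ X → b ∈ Y →
      evalP f (x t, b) = 0 → b = y t := by
    intro t b ht htU htX hbY hb
    obtain ⟨u, hu, hxu, hyu⟩ := h.exists_param hb
    have huU := hVU u hu (hXY ⟨by rwa [hxu], by rwa [hyu]⟩)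
    rw [Set.mem_ofPred_eq, hxu, htU] at huU
    rw [← hyu, ← huU]
  have hne : ∃ᶠ b in 𝓝 (y t₀), Q (x t₀) b (y t₀) ≠ 0 := by
    intro h1
    have h2 : ∀ᶠ b in 𝓝[≠] (y t₀), False := by
      filter_upwards [nhdsWithin_le_nhds h1, nhdsWithin_le_nhds hY, self_mem_nhdsWithin]
        with b hb hbY hbne
      refine hbne (hunique t₀ b ht₀ hleft.self_of_nhds (mem_of_mem_nhds hX) hbY ?_)
      have := hQ.sub_eq (x t₀) b (y t₀)
      rwa [not_not.mp hb, mul_zero, h.evalP_eq_zero ht₀, sub_zero] at this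
    exact h2.exists.elim fun _ h => h
  have hzero := eventually_exists_zero (G := fun t b => Q (x t) b (y t)) (t₀ := t₀) (y₀ := y t₀)
    (fun b => hQ.continuous.continuousAt.comp (f := fun z : ℂ × ℂ => (x z.1, z.2, y z.1))
      (ContinuousAt.prodMk (hcx.comp (x := (t₀, b)) continuousAt_fst)
        (continuousAt_snd.prodMk (hcy.comp (x := (t₀, b)) continuousAt_fst))))
    (fun t => hQ.differentiable (x t) (y t)) (by rw [hQ.diag, hy₀]) hne hY
  have hvan : ∀ᶠ t in 𝓝 t₀, evalP (MvPolynomial.pderiv 1 f) (x t, y t) = 0 := by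
    filter_upwards [hzero, hleft, hcx.eventually_mem hX, h0] with t ⟨b, hbY, hb⟩ htU htX ht
    have h1 := hQ.sub_eq (x t) b (y t)
    rw [hb, mul_zero, h.evalP_eq_zero ht, sub_zero] at h1
    rw [hunique t b ht htU htX hbY h1] at hb
    rw [← hQ.diag, hb]
  obtain ⟨t, ht, hne'⟩ := h.exists_pderiv_one_ne_zero ⟨t₀, ht₀, hd⟩
  exact hne' ((isLaurent_evalP _ h.laurent_x h.laurent_y).eq_zero_of_frequently ht₀
    (hvan.filter_mono nhdsWithin_le_nhds).frequently ht)

lemma pderiv_zero_ne_zero (hinj : Set.InjOn (fun t => (x t, y t)) {0}ᶜ)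
    (hprop : ∀ B : ℝ, ∃ K : Set ℂ, IsCompact K ∧ K ⊆ {0}ᶜ ∧
      ∀ t, t ≠ 0 → t ∉ K → B < ‖x t‖ ∨ B < ‖y t‖)
    {t₀ : ℂ} (ht₀ : t₀ ≠ 0) (hd : deriv y t₀ ≠ 0) :
    evalP (MvPolynomial.pderiv 0 f) (x t₀, y t₀) ≠ 0 := by
  have h1 := h.swap.pderiv_one_ne_zero
    (fun t ht u hu he => hinj ht hu (Prod.ext (Prod.mk.inj he).2 (Prod.mk.inj he).1))
    (fun B => by
      obtain ⟨K, hK, hK0, hB⟩ := hprop B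
      exact ⟨K, hK, hK0, fun t ht htK => (hB t ht htK).symm⟩) ht₀ hd
  have := MvPolynomial.pderiv_rename (Equiv.swap (0 : Fin 2) 1).injective 0 f
  rw [Equiv.swap_apply_left] at this
  rwa [this, evalP_rename_swap] at h1

end IsCurveParam

/-! ### The pulled back field is a rational vector field -/

/-- The field `v` on `ℂ*` is given by `t ^ m * P t / Q t` with polynomials `P` and `Q` that do not
vanish at `0`. -/
structure IsRationalField (v : ℂ → ℂ) (m : ℤ) (P Q : Polynomial ℂ) : Prop where
  num_ne_zero : P.eval 0 ≠ 0
  den_ne_zero : Q.eval 0 ≠ 0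
  eq : ∀ t, t ≠ 0 → Q.eval t ≠ 0 → v t = t ^ m * (P.eval t / Q.eval t)

lemma eventually_eval_ne_zero {Q : Polynomial ℂ} (hQ : Q ≠ 0) (t₀ : ℂ) :
    ∀ᶠ t in 𝓝[≠] t₀, Q.eval t ≠ 0 := by
  refine (Q.differentiable.analyticAt t₀).eventually_eq_zero_or_eventually_ne_zero.resolve_left
    fun h => hQ ?_
  have h1 : (fun t => Q.eval t) = fun _ => 0 :=
    AnalyticOnNhd.eq_of_eventuallyEq (z₀ := t₀) (fun y _ => Q.differentiable.analyticAt y)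
      (fun y _ => analyticAt_const) h
  exact Polynomial.funext fun t => by simpa using congrFun h1 t

lemma eventually_continuousAt_div {a b : ℂ → ℂ} (ha : Continuous a) (hb : Continuous b) {z₀ : ℂ}
    (h : b z₀ ≠ 0) : ∀ᶠ z in 𝓝 z₀, ContinuousAt (fun z => a z / b z) z :=
  (hb.continuousAt.eventually_ne h).mono fun _ hz => ha.continuousAt.div hb.continuousAt hz

lemma eventually_continuousAt_comp_inv {h : ℂ → ℝ} (hc : ContinuousOn h {0}ᶜ) :
    ∀ᶠ z in 𝓝[≠] (0 : ℂ), ContinuousAt (fun τ => h τ⁻¹) z := by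
  filter_upwards [self_mem_nhdsWithin] with z hz
  have h1 : ContinuousAt h z⁻¹ :=
    hc.continuousAt (isOpen_compl_singleton.mem_nhds (inv_ne_zero hz))
  exact ContinuousAt.comp (g := h) h1 (continuousAt_inv₀ hz)

lemma eval_inv_eq_reverse (P : Polynomial ℂ) {t : ℂ} (ht : t ≠ 0) :
    P.eval t⁻¹ = P.reverse.eval t * t ^ (-(P.natDegree : ℤ)) := by
  let _ : Invertible t⁻¹ := invertibleOfNonzero (inv_ne_zero ht)
  have := Polynomial.eval₂_reverse_mul_pow (RingHom.id ℂ) t⁻¹ P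
  simp only [invOf_eq_inv, inv_inv] at this
  rw [Polynomial.eval, Polynomial.eval, ← this, inv_pow, zpow_neg, zpow_natCast]

namespace IsRationalField

variable {v : ℂ → ℂ} {m : ℤ} {P Q : Polynomial ℂ} (hv : IsRationalField v m P Q)

include hv

lemma num_ne : P ≠ 0 := by
  rintro rfl
  exact hv.num_ne_zero (by simp)

lemma den_ne : Q ≠ 0 := by
  rintro rfl
  exact hv.den_ne_zero (by simp)

lemma hasIndex {t₀ : ℂ} (ht₀ : t₀ ≠ 0) :
    HasIndex v t₀ ((P.rootMultiplicity t₀ : ℤ) - Q.rootMultiplicity t₀) := by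
  obtain ⟨P₁, hP, hP₁⟩ :=
    Polynomial.exists_eq_pow_rootMultiplicity_mul_and_not_dvd P hv.num_ne t₀
  obtain ⟨Q₁, hQ, hQ₁⟩ :=
    Polynomial.exists_eq_pow_rootMultiplicity_mul_and_not_dvd Q hv.den_ne t₀
  rw [Polynomial.dvd_iff_isRoot, Polynomial.IsRoot.def] at hP₁ hQ₁
  have h0 : ∀ᶠ t in 𝓝 t₀, t ≠ 0 := isOpen_compl_singleton.mem_nhds ht₀
  refine hasIndex_of_eventuallyEq (c := fun _ => 1) (g := fun t => t ^ m * (P₁.eval t / Q₁.eval t))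
    (Eventually.of_forall fun _ => ⟨continuousAt_const, one_pos⟩) ?_
    (mul_ne_zero (zpow_ne_zero _ ht₀) (div_ne_zero hP₁ hQ₁)) ?_
  · filter_upwards [eventually_continuousAt_div P₁.continuous Q₁.continuous hQ₁, h0] with t h1 h2
    exact (continuousAt_zpow₀ _ _ (Or.inl h2)).mul h1
  · filter_upwards [nhdsWithin_le_nhds h0, eventually_eval_ne_zero hv.den_ne t₀,
      self_mem_nhdsWithin] with t ht htQ htt
    have h1 : t - t₀ ≠ 0 := sub_ne_zero.mpr htt
    have hPt := congrArg (Polynomial.eval t) hP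
    have hQt := congrArg (Polynomial.eval t) hQ
    simp only [Polynomial.eval_mul, Polynomial.eval_pow, Polynomial.eval_sub, Polynomial.eval_X,
      Polynomial.eval_C] at hPt hQt
    rw [hv.eq t ht htQ, hPt, hQt, zpow_sub₀ h1, zpow_natCast, zpow_natCast, mul_div_mul_comm]
    push_cast
    ring

lemma hasIndex_zero {h : ℂ → ℝ} (hc : ContinuousOn h {0}ᶜ) (hpos : ∀ t, t ≠ 0 → 0 < h t) :
    HasIndex (rescale h v) 0 m := by
  refine hasIndex_of_eventuallyEq (c := h) (g := fun t => P.eval t / Q.eval t) ?_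
    (eventually_continuousAt_div P.continuous Q.continuous hv.den_ne_zero)
    (div_ne_zero hv.num_ne_zero hv.den_ne_zero) ?_
  · filter_upwards [self_mem_nhdsWithin] with t ht
    exact ⟨hc.continuousAt (isOpen_compl_singleton.mem_nhds ht), hpos t ht⟩
  · filter_upwards [self_mem_nhdsWithin, eventually_eval_ne_zero hv.den_ne 0] with t ht htQ
    rw [rescale, hv.eq t ht htQ, sub_zero]

/-- `P(1/τ) = τ ^ (-deg P) P.reverse(τ)`, and `P.reverse` at `0` is the nonzero leading coefficient;
the chart factor `-τ ^ 2` adds `2`. -/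
lemma hasIndex_infty {h : ℂ → ℝ} (hc : ContinuousOn h {0}ᶜ) (hpos : ∀ t, t ≠ 0 → 0 < h t) :
    HasIndex (inftyChart (rescale h v)) 0 (2 - m - P.natDegree + Q.natDegree) := by
  have hrev : ∀ R : Polynomial ℂ, R ≠ 0 → R.reverse.eval 0 ≠ 0 := fun R hR => by
    rw [← Polynomial.coeff_zero_eq_eval_zero, Polynomial.coeff_zero_reverse]
    exact Polynomial.leadingCoeff_ne_zero.mpr hR
  refine hasIndex_of_eventuallyEq (c := fun τ => h τ⁻¹)
    (g := fun τ => -P.reverse.eval τ / Q.reverse.eval τ) ?_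
    (eventually_continuousAt_div P.reverse.continuous.neg Q.reverse.continuous
      (hrev Q hv.den_ne))
    (div_ne_zero (neg_ne_zero.mpr (hrev P hv.num_ne)) (hrev Q hv.den_ne)) ?_
  · filter_upwards [self_mem_nhdsWithin, eventually_continuousAt_comp_inv hc] with τ hτ hτc
    exact ⟨hτc, hpos _ (inv_ne_zero hτ)⟩
  · have hQ : Q.reverse ≠ 0 := fun h => hrev Q hv.den_ne (by simp [h])
    filter_upwards [self_mem_nhdsWithin, eventually_eval_ne_zero hQ 0] with τ hτ hτQ
    have hτ' : τ ≠ 0 := hτ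
    have h1 : Q.eval τ⁻¹ ≠ 0 := by
      rw [eval_inv_eq_reverse Q hτ]
      exact mul_ne_zero hτQ (zpow_ne_zero _ hτ)
    rw [inftyChart, rescale, hv.eq _ (inv_ne_zero hτ) h1, eval_inv_eq_reverse P hτ,
      eval_inv_eq_reverse Q hτ, sub_zero, zpow_add₀ hτ, zpow_sub₀ hτ, zpow_sub₀ hτ, inv_zpow]
    simp only [zpow_neg, zpow_natCast]
    have e2 : τ ^ (2 : ℤ) = τ ^ 2 := by norm_cast
    rw [e2]
    have hm : τ ^ m ≠ 0 := zpow_ne_zero _ hτ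
    field_simp

/-- Over `ℂ` the root multiplicities of a polynomial add up to its degree. Roots of `P` or `Q`
outside `T` have index zero, and common roots cancel. -/
lemma sum_index {T : Set ℂ} (hT : T.Finite) (h0 : (0 : ℂ) ∉ T)
    (hout : ∀ t, t ≠ 0 → t ∉ T → index v t = 0) :
    ∑ᶠ t ∈ T, (index v t : ℚ) = (P.natDegree : ℚ) - Q.natDegree := by
  classical
  set S : Finset ℂ := hT.toFinset ∪ (P.roots.toFinset ∪ Q.roots.toFinset) with hS
  have hroots : ∀ R : Polynomial ℂ, R.eval 0 ≠ 0 → (0 : ℂ) ∉ R.roots.toFinset := by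
    intro R hR h1
    rw [Multiset.mem_toFinset] at h1
    exact hR (Polynomial.isRoot_of_mem_roots h1)
  have hS0 : (0 : ℂ) ∉ S := by
    simp only [hS, Finset.mem_union, not_or, Set.Finite.mem_toFinset]
    exact ⟨h0, hroots P hv.num_ne_zero, hroots Q hv.den_ne_zero⟩
  have hcount : ∀ R : Polynomial ℂ, R.roots.toFinset ⊆ S →
      ∑ t ∈ S, (R.rootMultiplicity t : ℚ) = R.natDegree := by
    intro R hR
    rw [(IsAlgClosed.splits R).natDegree_eq_card_roots,
      ← Multiset.sum_count_eq_card (s := S) (m := R.roots)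
        fun a ha => hR (Multiset.mem_toFinset.mpr ha)]
    push_cast
    simp only [Polynomial.count_roots]
  rw [finsum_mem_eq_finite_toFinset_sum _ hT,
    Finset.sum_subset (s₂ := S) Finset.subset_union_left fun t htS htT => by
      rw [hout t (fun h => hS0 (h ▸ htS)) (by simpa using htT), Int.cast_zero],
    ← hcount P (Finset.subset_union_left.trans Finset.subset_union_right),
    ← hcount Q (Finset.subset_union_right.trans Finset.subset_union_right),
    ← Finset.sum_sub_distrib]
  refine Finset.sum_congr rfl fun t ht => ?_
  rw [(hv.hasIndex fun h => hS0 (h ▸ ht)).index_eq]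
  push_cast
  rfl

end IsRationalField

lemma exists_isRationalField_of_div {v a b : ℂ → ℂ} (ha : IsLaurent a) (hb : IsLaurent b)
    (ha' : ∃ t, t ≠ 0 ∧ a t ≠ 0) (hb' : ∃ t, t ≠ 0 ∧ b t ≠ 0)
    (hv : ∀ t, t ≠ 0 → b t ≠ 0 → v t = a t / b t) :
    ∃ m P Q, IsRationalField v m P Q := by
  obtain ⟨k, P, hP0, hP⟩ := ha.exists_eq_zpow_mul ha'
  obtain ⟨l, Q, hQ0, hQ⟩ := hb.exists_eq_zpow_mul hb'
  refine ⟨k - l, P, Q, hP0, hQ0, fun t ht htQ => ?_⟩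
  rw [hv t ht (by rw [hQ t ht]; exact mul_ne_zero (zpow_ne_zero _ ht) htQ), hP t ht, hQ t ht,
    zpow_sub₀ ht, mul_div_mul_comm]

/-! ### The field `ξ^* X_f` and the singular points -/

section Curve

variable {φ ψ : ℂ[T;T⁻¹]} {f : MvPolynomial (Fin 2) ℂ}
  (h : IsCurveParam (evalL φ) (evalL ψ) f)

include h

lemma IsCurveParam.exists_isRationalField :
    ∃ m P Q, IsRationalField (pullback f φ ψ) m P Q := by
  by_cases hφ : ∃ t, t ≠ 0 ∧ deriv (evalL φ) t ≠ 0
  · refine exists_isRationalField_of_div (isLaurent_evalP (MvPolynomial.pderiv 1 f) h.laurent_x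
      h.laurent_y) h.laurent_x.deriv (h.exists_pderiv_one_ne_zero hφ) hφ fun t _ htd => ?_
    rw [pullback, if_pos htd]
    rfl
  -- The curve is a vertical line, and the second branch of `pullback` applies at every `t ≠ 0`.
  · have hψ := h.exists_deriv_ne_zero.resolve_left hφ
    push Not at hφ
    refine exists_isRationalField_of_div (isLaurent_evalP (MvPolynomial.pderiv 0 f) h.laurent_x
      h.laurent_y).neg h.laurent_y.deriv ?_ hψ fun t ht _ => ?_
    · obtain ⟨t, ht, hne⟩ := h.swap.exists_pderiv_one_ne_zero hψ
      have := MvPolynomial.pderiv_rename (Equiv.swap (0 : Fin 2) 1).injective 0 f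
      rw [Equiv.swap_apply_left] at this
      rw [this, evalP_rename_swap] at hne
      exact ⟨t, ht, neg_ne_zero.mpr hne⟩
    · rw [pullback, if_neg (not_not.mpr (hφ t ht))]
      rfl

/-- Over the smooth points of the curve the field `ξ^* X_f` has no zeros and no poles. -/
lemma IsCurveParam.hasIndex_of_notMem {t₀ : ℂ} (ht₀ : t₀ ≠ 0)
    (hs : param φ ψ t₀ ∉ singularPoints f) : HasIndex (pullback f φ ψ) t₀ 0 := by
  have h0 : ∀ᶠ t in 𝓝 t₀, t ≠ 0 := isOpen_compl_singleton.mem_nhds ht₀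
  have key : ∀ a b : ℂ → ℂ, IsLaurent a → IsLaurent b → a t₀ ≠ 0 → b t₀ ≠ 0 →
      (∀ t, t ≠ 0 → b t ≠ 0 → pullback f φ ψ t = a t / b t) → HasIndex (pullback f φ ψ) t₀ 0 := by
    intro a b ha hb ha₀ hb₀ hab
    have hb' : ∀ᶠ t in 𝓝 t₀, b t ≠ 0 := (hb.differentiableAt ht₀).continuousAt.eventually_ne hb₀
    refine hasIndex_of_eventuallyEq (c := fun _ => 1) (g := fun t => a t / b t)
      (Eventually.of_forall fun _ => ⟨continuousAt_const, one_pos⟩) ?_ (div_ne_zero ha₀ hb₀) ?_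
    · filter_upwards [h0, hb'] with t ht htb
      exact (ha.differentiableAt ht).continuousAt.div (hb.differentiableAt ht).continuousAt htb
    · filter_upwards [nhdsWithin_le_nhds h0, nhdsWithin_le_nhds hb'] with t ht htb
      simp [hab t ht htb]
  by_cases h1 : evalP (MvPolynomial.pderiv 1 f) (param φ ψ t₀) = 0
  · have h2 : evalP (MvPolynomial.pderiv 0 f) (param φ ψ t₀) ≠ 0 := fun h2 =>
      hs ⟨h.evalP_eq_zero ht₀, h2, h1⟩
    refine key _ _ (isLaurent_evalP (MvPolynomial.pderiv 0 f) h.laurent_x h.laurent_y).neg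
      h.laurent_y.deriv (neg_ne_zero.mpr h2) (h.deriv_right_ne_zero ht₀ h2) fun t ht htd => ?_
    rw [pullback]
    -- Where both derivatives are nonzero, the chain rule makes the two formulas for the field
    -- agree.
    split_ifs with hd
    · rw [div_eq_div_iff hd htd]
      have := h.chain_rule ht
      rw [param]
      linear_combination this
    · rfl
  · refine key _ _ (isLaurent_evalP (MvPolynomial.pderiv 1 f) h.laurent_x h.laurent_y)
      h.laurent_x.deriv h1 (h.deriv_left_ne_zero ht₀ h1) fun t ht htd => ?_
    rw [pullback, if_pos htd]
    rfl

lemma IsCurveParam.finite_singular :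
    {t : ℂ | t ≠ 0 ∧ param φ ψ t ∈ singularPoints f}.Finite := by
  obtain ⟨⟨a, b⟩, hP, hne⟩ := exists_pderiv_ne_zero h.squarefree
    ⟨_, h.evalP_eq_zero one_ne_zero⟩
  obtain ⟨t, ht, rfl, rfl⟩ := h.exists_param hP
  rcases hne with hne | hne
  · exact ((isLaurent_evalP _ h.laurent_x h.laurent_y).finite_zeros ⟨t, ht, hne⟩).subset
      fun u hu => ⟨hu.1, hu.2.2.1⟩
  · exact ((isLaurent_evalP _ h.laurent_x h.laurent_y).finite_zeros ⟨t, ht, hne⟩).subset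
      fun u hu => ⟨hu.1, hu.2.2.2⟩

lemma IsCurveParam.image_singular :
    param φ ψ '' {t : ℂ | t ≠ 0 ∧ param φ ψ t ∈ singularPoints f} = singularPoints f := by
  ext ⟨a, b⟩
  constructor
  · rintro ⟨t, ht, he⟩
    exact he ▸ ht.2
  · intro hs
    obtain ⟨t, ht, rfl, rfl⟩ := h.exists_param hs.1
    exact ⟨t, ⟨ht, hs⟩, rfl⟩

/-- The preimages of the singular points are partitioned into the finite fibres of `ξ`. -/
lemma IsCurveParam.finsum_deltaPoint :
    ∑ᶠ P ∈ singularPoints f, 2 * deltaPoint f φ ψ P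
      = ∑ᶠ t ∈ {t : ℂ | t ≠ 0 ∧ param φ ψ t ∈ singularPoints f}, (index (pullback f φ ψ) t : ℚ) := by
  have hfin := h.finite_singular
  have hU : {t : ℂ | t ≠ 0 ∧ param φ ψ t ∈ singularPoints f}
      = ⋃ P ∈ singularPoints f, {t : ℂ | t ≠ 0 ∧ param φ ψ t = P} := by
    ext t
    simp
  rw [hU, finsum_mem_biUnion]
  · refine finsum_mem_congr rfl fun P _ => ?_
    rw [deltaPoint]
    ring
  · intro P _ R _ hne
    refine Set.disjoint_left.mpr fun t ht ht' => hne ?_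
    rw [← ht.2, ht'.2]
  · rw [← h.image_singular]
    exact hfin.image _
  · exact fun P hP => hfin.subset fun t ht => ⟨ht.1, by rw [ht.2]; exact hP⟩

end Curve

/-! ### Assembly of the double point formula -/

lemma IsParametrizedAnnulus.isCurveParam {φ ψ : ℂ[T;T⁻¹]} {p q r s : ℤ}
    (h : IsParametrizedAnnulus φ ψ p q r s) {f : MvPolynomial (Fin 2) ℂ}
    (hf : IsReducedEquation f φ ψ) : IsCurveParam (evalL φ) (evalL ψ) f where
  laurent_x := isLaurent_evalL φ
  laurent_y := isLaurent_evalL ψ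
  squarefree := hf.squarefree
  zeros := hf.zeros
  finite := h.generically_injective

/-- From `2 max(a, b) = a + b + |a - b|` one gets `2 δ_{0,max} + 2 δ_{∞,max} = 2 δ_max + 2`, so both
cases of the definition give `2 δ_max - (2 - i - i₀)`. -/
lemma two_mul_deltaInf_add {p q r s i₀ i : ℤ} {d : ℚ} (hd : (i₀ : ℚ) + i + d = 2) :
    2 * deltaInf p q r s i₀ i + d = 2 * deltaMax p q r s := by
  rw [deltaInf]
  split_ifs with hps
  · linear_combination hd
  · have hmax : (2 * max (p * s) (r * q) : ℤ) = p * s + r * q + |p * s - r * q| := by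
      rw [two_mul, max_def, abs_eq_max_neg, max_def]
      split_ifs <;> omega
    have hmax' : (2 * (max (p * s) (r * q) : ℤ) : ℚ)
        = ((p * s + r * q + |p * s - r * q| : ℤ) : ℚ) := by exact_mod_cast hmax
    rw [deltaZero, deltaInfty, deltaZeroMax, deltaInftyMax, deltaMax]
    generalize max (p * s) (r * q) = M at *
    generalize |p * s - r * q| = N at *
    push_cast at hmax' ⊢
    linear_combination hd + hmax'

end PlaneAnnulus

end

theorem proposition2p15 (φ ψ : LaurentPolynomial ℂ) (p q r s : ℤ)
    (hξ : PlaneAnnulus.IsParametrizedAnnulus φ ψ p q r s)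
    (f : MvPolynomial (Fin 2) ℂ) (hf : PlaneAnnulus.IsReducedEquation f φ ψ)
    (h : ℂ → ℝ) (hh : PlaneAnnulus.IsTaming h (PlaneAnnulus.pullback f φ ψ))
    (i₀ i : ℤ)
    (hi₀ : i₀ = PlaneAnnulus.index
      (PlaneAnnulus.rescale h (PlaneAnnulus.pullback f φ ψ)) 0)
    (hi : i = PlaneAnnulus.index (PlaneAnnulus.inftyChart
      (PlaneAnnulus.rescale h (PlaneAnnulus.pullback f φ ψ))) 0) :
    -- all the indices are well defined, and the sum is finite
    (∀ t : ℂ, t ≠ 0 → ∃! n : ℤ, PlaneAnnulus.HasIndex (PlaneAnnulus.pullback f φ ψ) t n) ∧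
    (∃! n : ℤ, PlaneAnnulus.HasIndex
      (PlaneAnnulus.rescale h (PlaneAnnulus.pullback f φ ψ)) 0 n) ∧
    (∃! n : ℤ, PlaneAnnulus.HasIndex (PlaneAnnulus.inftyChart
      (PlaneAnnulus.rescale h (PlaneAnnulus.pullback f φ ψ))) 0 n) ∧
    {t : ℂ | t ≠ 0 ∧ PlaneAnnulus.param φ ψ t ∈ PlaneAnnulus.singularPoints f}.Finite ∧
    -- the identity, for `p s ≠ r q` and for `p s = r q`
    2 * PlaneAnnulus.deltaInf p q r s i₀ i
      + ∑ᶠ P ∈ PlaneAnnulus.singularPoints f, 2 * PlaneAnnulus.deltaPoint f φ ψ P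
      = 2 * PlaneAnnulus.deltaMax p q r s ∧
    -- without self-intersections only cuspidal points, those with `ξ' = 0`, contribute
    (PlaneAnnulus.NoSelfIntersections φ ψ →
      (∀ t : ℂ, t ≠ 0 → (PlaneAnnulus.param φ ψ t ∈ PlaneAnnulus.singularPoints f ↔
        deriv (PlaneAnnulus.evalL φ) t = 0 ∧ deriv (PlaneAnnulus.evalL ψ) t = 0)) ∧
      2 * PlaneAnnulus.deltaInf p q r s i₀ i
        + ∑ᶠ t ∈ {t : ℂ | t ≠ 0 ∧ deriv (PlaneAnnulus.evalL φ) t = 0 ∧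
            deriv (PlaneAnnulus.evalL ψ) t = 0},
          2 * PlaneAnnulus.deltaPoint f φ ψ (PlaneAnnulus.param φ ψ t)
        = 2 * PlaneAnnulus.deltaMax p q r s) := by
  have hc : PlaneAnnulus.IsCurveParam (PlaneAnnulus.evalL φ) (PlaneAnnulus.evalL ψ) f := hξ.isCurveParam hf
  obtain ⟨m, P, Q, hX⟩ := hc.exists_isRationalField
  have hcont : ContinuousOn h {0}ᶜ := hh.smooth.continuousOn
  have hind₀ := hX.hasIndex_zero hcont hh.pos
  have hind := hX.hasIndex_infty hcont hh.pos
  have hfin := hc.finite_singular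
  rw [hind₀.index_eq] at hi₀
  rw [hind.index_eq] at hi
  have hsum := hX.sum_index hfin (fun h0 => h0.1 rfl) fun t ht htT =>
    (hc.hasIndex_of_notMem ht fun hs => htT ⟨ht, hs⟩).index_eq
  have hmain := PlaneAnnulus.two_mul_deltaInf_add (p := p) (q := q) (r := r) (s := s) (i₀ := i₀)
    (i := i) (d := (P.natDegree : ℚ) - Q.natDegree) (by
      rw [hi₀, hi]
      push_cast
      ring)
  rw [← hsum, ← hc.finsum_deltaPoint] at hmain
  refine ⟨fun t ht => (hX.hasIndex ht).existsUnique, hind₀.existsUnique, hind.existsUnique, hfin,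
    hmain, fun hinj => ?_⟩
  have hcusp : ∀ t : ℂ, t ≠ 0 → (PlaneAnnulus.param φ ψ t ∈ PlaneAnnulus.singularPoints f ↔
      deriv (PlaneAnnulus.evalL φ) t = 0 ∧ deriv (PlaneAnnulus.evalL ψ) t = 0) := by
    refine fun t ht => ⟨fun hs => ⟨?_, ?_⟩, fun hd => ⟨hc.evalP_eq_zero ht, ?_, ?_⟩⟩
    · by_contra hd
      exact hc.pderiv_one_ne_zero hinj hξ.exists_isCompact ht hd hs.2.2
    · by_contra hd
      exact hc.pderiv_zero_ne_zero hinj hξ.exists_isCompact ht hd hs.2.1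
    · by_contra hne
      exact hc.deriv_right_ne_zero ht hne hd.2
    · by_contra hne
      exact hc.deriv_left_ne_zero ht hne hd.1
  refine ⟨hcusp, ?_⟩
  have hset : {t : ℂ | t ≠ 0 ∧ deriv (PlaneAnnulus.evalL φ) t = 0 ∧
      deriv (PlaneAnnulus.evalL ψ) t = 0}
      = {t : ℂ | t ≠ 0 ∧ PlaneAnnulus.param φ ψ t ∈ PlaneAnnulus.singularPoints f} := by
    ext t
    exact and_congr_right fun ht => (hcusp t ht).symm
  rw [hset, ← hmain]
  congr 1
  -- Injectivity of `ξ` lets the sum over parameters be rewritten as a sum over singular points.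
  rw [← finsum_mem_image (f := fun R => 2 * PlaneAnnulus.deltaPoint f φ ψ R)
    (hinj.mono fun t ht => ht.1), hc.image_singular]
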